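/- Let $k$ be a field, let $\mathfrak g$ and $\mathfrak g'$ be Lie algebras over $k$ with ideals $\mathfrak h\subset\mathfrak g$ and $\mathfrak h'\subset\mathfrak g'$, and let $\alpha:\mathfrak g'\to\mathfrak g$ be a Lie algebra homomorphism with $\alpha(\mathfrak h')\subset\mathfrak h$, so that $\alpha$ induces $\mathfrak h'\to\mathfrak h$ and $\overline\alpha:\mathfrak g'/\mathfrak h'\to\mathfrak g/\mathfrak h$. Let $M$ be a $\mathfrak g$-module, regarded as a $\mathfrak g'$-module via $\alpha$; then $M^{\mathfrak h}\subset M^{\mathfrak h'}$. **Conventions.** $H^n$ is Chevalley–Eilenberg cohomology; $H^1(\mathfrak g,M)$ is derivations modulo inner derivations. $\mathfrak g$ acts on $\mathrm{Der}(\mathfrak h,M)$ by $({}^xd)(z)=x\cdot d(z)-d([x,z])$, which induces an action of $\mathfrak g/\mathfrak h$ on $H^1(\mathfrak h,M)$. For $m\in M$ let $\delta(m)$ be the derivation $z\mapsto z\cdot m$. Let $H^2(\mathfrak g,M)_1=\ker\big(H^2(\mathfrak g,M)\to H^2(\mathfrak h,M)\big)$ (restriction). An extension $0\to M\to\mathfrak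 e\xrightarrow{p}\mathfrak g\to0$ has its usual class in $H^2(\mathfrak g,M)$, that of $(x,y)\mapsto[\sigma x,\sigma y]-\sigma[x,y]$ for a linear section $\sigma$ of $p$. A crossed extension $0\to N\to\mathfrak m\xrightarrow{\partial}\mathfrak n\to\mathfrak q\to0$ (an exact sequence in which $\partial$ is a crossed module of Lie algebras inducing the given action of $\mathfrak q$ on $N$) has its usual class in $H^3(\mathfrak q,N)$: for a linear section $\sigma:\mathfrak q\to\mathfrak n$ and an alternating bilinear $F:\mathfrak q\times\mathfrak q\to\mathfrak m$ with $\partial F(x,y)=[\sigma x,\sigma y]-\sigma[x,y]$, it is the class of the formal Chevalley–Eilenberg coboundary of $F$, with $\mathfrak q$ acting on $\mathfrak m$ through $\sigma$. These classes do not depend on the choices. **The maps.** * $\mathrm{tr}:H^1(\mathfrak h,M)^{\mathfrak g/\mathfrak h}\to H^2(\mathfrak g/\mathfrak h,M^{\mathfrak h})$. For a derivation $d:\mathfrak h\to M$ with invariant class put $s_d(z)=(d(z),z)\in M\rtimes\mathfrak g$ and let $I$ be the largest subalgebra of $M\rtimes\mathfrak g$ in which $s_d(\mathfrak h)$ is an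 ideal. Then $\mathrm{tr}[d]$ is the class of $0\to M^{\mathfrak h}\to I/s_d(\mathfrak h)\to\mathfrak g/\mathfrak h\to0$. * $\rho:H^2(\mathfrak g,M)_1\to H^1(\mathfrak g/\mathfrak h,H^1(\mathfrak h,M))$. Represent a class by an extension $0\to M\to\mathfrak e\xrightarrow{p}\mathfrak g\to0$ with a Lie algebra homomorphism $s:\mathfrak h\to\mathfrak e$ such that $p\circ s=\mathrm{id}_{\mathfrak h}$, and for $y\in\mathfrak e$ let $d_y\in\mathrm{Der}(\mathfrak h,M)$ be $d_y(z)=[y,s(z)]-s([p(y),z])$. Then $\rho$ of the class is the class of the derivation $p(y)+\mathfrak h\mapsto[d_y]$. * $\lambda:H^1(\mathfrak g/\mathfrak h,H^1(\mathfrak h,M))\to H^3(\mathfrak g/\mathfrak h,M^{\mathfrak h})$. For a derivation $D:\mathfrak g/\mathfrak h\to H^1(\mathfrak h,M)$ let $\mathfrak p$ be the subalgebra of $\mathrm{Der}(\mathfrak h,M)\rtimes\mathfrak g$ of all $(d,x)$ with $D(x+\mathfrak h)=[d]$. Then $\lambda[D]$ is the class of the crossed extension $0\to M^{\mathfrak h}\to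 M\rtimes\mathfrak h\xrightarrow{\gamma}\mathfrak p\to\mathfrak g/\mathfrak h\to0$ with $\gamma(m,z)=(-\delta(m),z)$ and action ${}^{(d,x)}(m,z)=(x\cdot m+d(z),[x,z])$. Each $\alpha^*$ below is induced on cochains by composition with $\alpha$ or $\overline\alpha$ in the Lie algebra variables and, in the coefficients, with the identity of $M$, the inclusion $M^{\mathfrak h}\hookrightarrow M^{\mathfrak h'}$, or $\alpha^*:H^1(\mathfrak h,M)\to H^1(\mathfrak h',M)$, $[d]\mapsto[d\circ\alpha]$. **Claim.** The following squares commute: $$\begin{array}{ccc}H^1(\mathfrak h,M)^{\mathfrak g/\mathfrak h}&\xrightarrow{\ \mathrm{tr}\ }&H^2(\mathfrak g/\mathfrak h,M^{\mathfrak h})\\ {\scriptstyle\alpha^*}\downarrow&&\downarrow{\scriptstyle\alpha^*}\\ H^1(\mathfrak h',M)^{\mathfrak g'/\mathfrak h'}&\xrightarrow{\ \mathrm{tr}\ }&H^2(\mathfrak g'/\mathfrak h',M^{\mathfrak h'})\end{array}$$ $$\begin{array}{ccc}H^2(\mathfrak g,M)_1&\xrightarrow{\ \rho\ }&H^1(\mathfrak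 g/\mathfrak h,H^1(\mathfrak h,M))\\ {\scriptstyle\alpha^*}\downarrow&&\downarrow{\scriptstyle\alpha^*}\\ H^2(\mathfrak g',M)_1&\xrightarrow{\ \rho\ }&H^1(\mathfrak g'/\mathfrak h',H^1(\mathfrak h',M))\end{array}$$ $$\begin{array}{ccc}H^1(\mathfrak g/\mathfrak h,H^1(\mathfrak h,M))&\xrightarrow{\ \lambda\ }&H^3(\mathfrak g/\mathfrak h,M^{\mathfrak h})\\ {\scriptstyle\alpha^*}\downarrow&&\downarrow{\scriptstyle\alpha^*}\\ H^1(\mathfrak g'/\mathfrak h',H^1(\mathfrak h',M))&\xrightarrow{\ \lambda\ }&H^3(\mathfrak g'/\mathfrak h',M^{\mathfrak h'})\end{array}$$ The maps $\alpha^*$ also commute with the inflation maps $H^1(\mathfrak g/\mathfrak h,M^{\mathfrak h})\to H^1(\mathfrak g,M)$ and $H^2(\mathfrak g/\mathfrak h,M^{\mathfrak h})\to H^2(\mathfrak g,M)_1$ and with the restriction map $H^1(\mathfrak g,M)\to H^1(\mathfrak h,M)^{\mathfrak g/\mathfrak h}$. Hence the $\alpha^*$ form a morphism from the sequence $$0\to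 H^1(\mathfrak g/\mathfrak h,M^{\mathfrak h})\to H^1(\mathfrak g,M)\to H^1(\mathfrak h,M)^{\mathfrak g/\mathfrak h}\xrightarrow{\mathrm{tr}}H^2(\mathfrak g/\mathfrak h,M^{\mathfrak h})\to H^2(\mathfrak g,M)_1\xrightarrow{\rho}H^1(\mathfrak g/\mathfrak h,H^1(\mathfrak h,M))\xrightarrow{\lambda}H^3(\mathfrak g/\mathfrak h,M^{\mathfrak h})$$ to the corresponding sequence for $(\mathfrak g',\mathfrak h')$. -/

import Mathlib

open LieModule.Cohomology

set_option linter.unusedSimpArgs false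
set_option linter.unusedSectionVars false

namespace LieExt

section Cohomology

variable (k L M : Type*) [Field k] [LieRing L] [LieAlgebra k L]
  [AddCommGroup M] [Module k M] [LieRingModule L M] [LieModule k L M]

/-- `H¹(L, M)`: derivations modulo inner derivations. -/
def H1 : Type _ := LieDerivation k L M ⧸ LinearMap.range (LieDerivation.inner k L M)

instance : AddCommGroup (H1 k L M) :=
  inferInstanceAs (AddCommGroup (LieDerivation k L M ⧸ LinearMap.range (LieDerivation.inner k L M)))

instance : Module k (H1 k L M) :=
  inferInstanceAs (Module k (LieDerivation k L M ⧸ LinearMap.range (LieDerivation.inner k L M)))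

/-- The class of a derivation in `H¹(L, M)`. -/
def H1.mk : LieDerivation k L M →ₗ[k] H1 k L M :=
  (LinearMap.range (LieDerivation.inner k L M)).mkQ

variable {k L M} in
lemma H1.mk_eq_zero {d : LieDerivation k L M} :
    H1.mk k L M d = 0 ↔ ∃ m, LieDerivation.inner k L M m = d :=
  Submodule.Quotient.mk_eq_zero _

variable {k L M} in
lemma H1.exists_rep (c : H1 k L M) : ∃ d, H1.mk k L M d = c :=
  Submodule.Quotient.mk_surjective _ c

instance : AddCommGroup (twoCochain k L M) := Submodule.addCommGroup _

instance : AddCommGroup (twoCocycle k L M) := Submodule.addCommGroup _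

/-- `H²(L, M)`: Chevalley-Eilenberg 2-cocycles modulo 2-coboundaries. -/
def H2 : Type _ :=
  twoCocycle k L M ⧸ (LinearMap.range (d₁₂ k L M)).comap (twoCocycle k L M).subtype

instance : AddCommGroup (H2 k L M) := inferInstanceAs (AddCommGroup
  (twoCocycle k L M ⧸ (LinearMap.range (d₁₂ k L M)).comap (twoCocycle k L M).subtype))

instance : Module k (H2 k L M) := inferInstanceAs (Module k
  (twoCocycle k L M ⧸ (LinearMap.range (d₁₂ k L M)).comap (twoCocycle k L M).subtype))

/-- The class of a 2-cocycle in `H²(L, M)`. -/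
def H2.mk : twoCocycle k L M →ₗ[k] H2 k L M :=
  ((LinearMap.range (d₁₂ k L M)).comap (twoCocycle k L M).subtype).mkQ

instance : AddCommGroup (L →ₗ[k] L →ₗ[k] M) := LinearMap.addCommGroup

instance : AddCommGroup (L →ₗ[k] L →ₗ[k] L →ₗ[k] M) := LinearMap.addCommGroup

/-- Chevalley-Eilenberg 3-cocycles: alternating trilinear maps killed by the coboundary. -/
def threeCocycle : Submodule k (L →ₗ[k] L →ₗ[k] L →ₗ[k] M) where
  carrier := {c | (∀ x y, c x x y = 0) ∧ (∀ x y, c x y y = 0) ∧ ∀ w x y z,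
    ⁅w, c x y z⁆ - ⁅x, c w y z⁆ + ⁅y, c w x z⁆ - ⁅z, c w x y⁆
      - c ⁅w, x⁆ y z + c ⁅w, y⁆ x z - c ⁅w, z⁆ x y
      - c ⁅x, y⁆ w z + c ⁅x, z⁆ w y - c ⁅y, z⁆ w x = 0}
  add_mem' {a b} ha hb := by
    refine ⟨fun x y => by simp [ha.1, hb.1], fun x y => by simp [ha.2.1, hb.2.1],
      fun w x y z => ?_⟩
    have h1 := ha.2.2 w x y z
    have h2 := hb.2.2 w x y z
    rw [← add_zero (0 : M)]
    nth_rewrite 1 [← h1]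
    rw [← h2]
    simp only [LinearMap.add_apply, lie_add]
    abel
  zero_mem' := by simp
  smul_mem' t a ha := by
    refine ⟨fun x y => by simp [ha.1], fun x y => by simp [ha.2.1], fun w x y z => ?_⟩
    have h1 := ha.2.2 w x y z
    rw [← smul_zero t, ← h1]
    simp only [LinearMap.smul_apply, lie_smul, smul_add, smul_sub]

instance : AddCommGroup (threeCocycle k L M) := Submodule.addCommGroup _

/-- `H³(L, M)`: Chevalley-Eilenberg 3-cocycles modulo 3-coboundaries. -/
def H3 : Type _ :=
  threeCocycle k L M ⧸ (LinearMap.range (d₂₃ k L M)).comap (threeCocycle k L M).subtype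

instance : AddCommGroup (H3 k L M) := inferInstanceAs (AddCommGroup
  (threeCocycle k L M ⧸ (LinearMap.range (d₂₃ k L M)).comap (threeCocycle k L M).subtype))

instance : Module k (H3 k L M) := inferInstanceAs (Module k
  (threeCocycle k L M ⧸ (LinearMap.range (d₂₃ k L M)).comap (threeCocycle k L M).subtype))

/-- The class of a 3-cocycle in `H³(L, M)`. -/
def H3.mk : threeCocycle k L M →ₗ[k] H3 k L M :=
  ((LinearMap.range (d₂₃ k L M)).comap (threeCocycle k L M).subtype).mkQ

end Cohomology

section Functoriality

variable {k L L' M M' : Type*} [Field k] [LieRing L] [LieAlgebra k L]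
  [LieRing L'] [LieAlgebra k L']
  [AddCommGroup M] [Module k M] [LieRingModule L M] [LieModule k L M]
  [AddCommGroup M'] [Module k M'] [LieRingModule L' M'] [LieModule k L' M']

/-- A Lie algebra map `φ : L' → L` and a linear map `ψ : M → M'` from an `L`-module to an
`L'`-module are compatible if `ψ` is `L'`-equivariant for the action on `M` through `φ`. -/
def Compat (φ : L' →ₗ⁅k⁆ L) (ψ : M →ₗ[k] M') : Prop :=
  ∀ (x : L') (m : M), ψ ⁅φ x, m⁆ = ⁅x, ψ m⁆

/-- `d ↦ ψ ∘ d ∘ φ` on derivations. -/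
def derMap (φ : L' →ₗ⁅k⁆ L) (ψ : M →ₗ[k] M') (H : Compat φ ψ) :
    LieDerivation k L M →ₗ[k] LieDerivation k L' M' where
  toFun d :=
    { toLinearMap := ψ ∘ₗ (d : L →ₗ[k] M) ∘ₗ (φ : L' →ₗ[k] L)
      leibniz' := fun x y => by simp [← H x, ← H y] }
  map_add' _ _ := by ext; simp
  map_smul' _ _ := by ext; simp

@[simp] lemma derMap_apply (φ : L' →ₗ⁅k⁆ L) (ψ : M →ₗ[k] M') (H : Compat φ ψ)
    (d : LieDerivation k L M) (x : L') : derMap φ ψ H d x = ψ (d (φ x)) := rfl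

/-- The map induced on `H¹` by a compatible pair. -/
def H1.map (φ : L' →ₗ⁅k⁆ L) (ψ : M →ₗ[k] M') (H : Compat φ ψ) :
    H1 k L M →ₗ[k] H1 k L' M' :=
  Submodule.mapQ _ _ (derMap φ ψ H) (by
    rintro _ ⟨m, rfl⟩
    exact ⟨ψ m, by ext x; simp [H x m]⟩)

/-- The map induced on 2-cochains: `f ↦ ψ ∘ f ∘ (φ × φ)`. -/
def twoCochainMap (φ : L' →ₗ⁅k⁆ L) (ψ : M →ₗ[k] M') :
    twoCochain k L M →ₗ[k] twoCochain k L' M' where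
  toFun f :=
    ⟨LinearMap.mk₂ k (fun x y => ψ (f (φ x) (φ y))) (by simp) (by simp) (by simp) (by simp),
      fun x => by simp⟩
  map_add' _ _ := by ext; simp
  map_smul' _ _ := by ext; simp

set_option linter.unusedSectionVars false in
@[simp] lemma twoCochainMap_apply (φ : L' →ₗ⁅k⁆ L) (ψ : M →ₗ[k] M')
    (f : twoCochain k L M) (x y : L') : twoCochainMap φ ψ f x y = ψ (f (φ x) (φ y)) := rfl

lemma d₂₃_twoCochainMap (φ : L' →ₗ⁅k⁆ L) (ψ : M →ₗ[k] M') (H : Compat φ ψ)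
    (f : twoCochain k L M) (x y z : L') :
    d₂₃ k L' M' (twoCochainMap φ ψ f) x y z = ψ (d₂₃ k L M f (φ x) (φ y) (φ z)) := by
  simp [H _ _]

/-- The map induced on 2-cocycles by a compatible pair. -/
def twoCocycleMap (φ : L' →ₗ⁅k⁆ L) (ψ : M →ₗ[k] M') (H : Compat φ ψ) :
    twoCocycle k L M →ₗ[k] twoCocycle k L' M' :=
  (twoCochainMap φ ψ).restrict fun f hf => by
    rw [mem_twoCocycle_iff] at hf ⊢
    ext x y z
    simp [-d₂₃_apply, d₂₃_twoCochainMap φ ψ H, hf]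

@[simp] lemma twoCocycleMap_apply (φ : L' →ₗ⁅k⁆ L) (ψ : M →ₗ[k] M') (H : Compat φ ψ)
    (f : twoCocycle k L M) (x y : L') :
    (twoCocycleMap φ ψ H f).1 x y = ψ (f.1 (φ x) (φ y)) := rfl

/-- The map induced on `H²` by a compatible pair. -/
def H2.map (φ : L' →ₗ⁅k⁆ L) (ψ : M →ₗ[k] M') (H : Compat φ ψ) :
    H2 k L M →ₗ[k] H2 k L' M' :=
  Submodule.mapQ _ _ (twoCocycleMap φ ψ H) (by
    rintro f ⟨γ, hγ⟩
    refine ⟨ψ ∘ₗ γ ∘ₗ (φ : L' →ₗ[k] L), ?_⟩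
    ext x y
    have h := congrArg ψ (congrArg (fun t : twoCochain k L M => t (φ x) (φ y)) hγ)
    simp only [d₁₂_apply_apply, map_sub, H _ _] at h
    exact (by simpa using h))

/-- The map induced on 3-cocycles by a compatible pair. -/
def threeCocycleMap (φ : L' →ₗ⁅k⁆ L) (ψ : M →ₗ[k] M') (H : Compat φ ψ) :
    threeCocycle k L M →ₗ[k] threeCocycle k L' M' where
  toFun c :=
    ⟨{ toFun := fun x =>
        LinearMap.mk₂ k (fun y z => ψ (c.1 (φ x) (φ y) (φ z))) (by simp) (by simp) (by simp)
          (by simp)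
       map_add' := fun _ _ => by ext; simp
       map_smul' := fun _ _ => by ext; simp },
      fun x y => by simp [c.2.1], fun x y => by simp [c.2.2.1], fun w x y z => by
        have h := congrArg ψ (c.2.2.2 (φ w) (φ x) (φ y) (φ z))
        simp only [map_add, map_sub, H _ _, map_zero] at h
        simpa using h⟩
  map_add' _ _ := by ext; simp
  map_smul' _ _ := by ext; simp

/-- The map induced on `H³` by a compatible pair. -/
def H3.map (φ : L' →ₗ⁅k⁆ L) (ψ : M →ₗ[k] M') (H : Compat φ ψ) :
    H3 k L M →ₗ[k] H3 k L' M' :=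
  Submodule.mapQ _ _ (threeCocycleMap φ ψ H) (by
    rintro c ⟨f, hf⟩
    refine ⟨twoCochainMap φ ψ f, ?_⟩
    ext x y z
    rw [d₂₃_twoCochainMap φ ψ H, hf]
    rfl)

end Functoriality

section Extensions

/-- An extension `0 → M → E → L → 0` of the Lie algebra `L` by the `L`-module `M`: an exact
sequence in which the action of `L` on `M` induced by the bracket of `E` is the given one.
(Taking `proj e = 0` in `lie_incl` shows that `M` is an abelian ideal.) -/
structure ModExt (k L M E : Type*) [Field k] [LieRing L] [LieAlgebra k L]
    [AddCommGroup M] [Module k M] [LieRingModule L M] [LieModule k L M]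
    [LieRing E] [LieAlgebra k E] where
  /-- the inclusion of `M` -/
  incl : M →ₗ[k] E
  /-- the projection onto `L` -/
  proj : E →ₗ⁅k⁆ L
  incl_injective : Function.Injective incl
  proj_surjective : Function.Surjective proj
  exact : ∀ e : E, proj e = 0 ↔ ∃ m, incl m = e
  lie_incl : ∀ (e : E) (m : M), ⁅e, incl m⁆ = incl ⁅proj e, m⁆

variable {k L M E : Type*} [Field k] [LieRing L] [LieAlgebra k L]
  [AddCommGroup M] [Module k M] [LieRingModule L M] [LieModule k L M]
  [LieRing E] [LieAlgebra k E]

namespace ModExt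

variable (X : ModExt k L M E)

lemma exists_retraction : ∃ r : E →ₗ[k] M, r ∘ₗ X.incl = LinearMap.id :=
  LinearMap.exists_leftInverse_of_injective _ (LinearMap.ker_eq_bot.2 X.incl_injective)

/-- A linear retraction of the inclusion; it is only applied to elements of the image of `M`,
where it is the inverse of the inclusion. -/
noncomputable def toM : E →ₗ[k] M := X.exists_retraction.choose

@[simp] lemma toM_incl (m : M) : X.toM (X.incl m) = m :=
  LinearMap.congr_fun X.exists_retraction.choose_spec m

lemma incl_toM {e : E} (he : X.proj e = 0) : X.incl (X.toM e) = e := by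
  obtain ⟨m, rfl⟩ := (X.exact e).1 he
  rw [toM_incl]

@[simp] lemma proj_incl (m : M) : X.proj (X.incl m) = 0 := (X.exact _).2 ⟨m, rfl⟩

/-- The 2-cochain `f (x, y) = [s x, s y] - s [x, y]` of an extension with a linear section `s`. -/
noncomputable def cochainOf (s : L →ₗ[k] E) : twoCochain k L M :=
  ⟨LinearMap.mk₂ k (fun x y => X.toM (⁅s x, s y⁆ - s ⁅x, y⁆))
      (fun _ _ _ => by simp only [map_add, add_lie, map_sub]; abel)
      (fun _ _ _ => by simp only [map_smul, smul_lie, map_sub, smul_sub])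
      (fun _ _ _ => by simp only [map_add, lie_add, map_sub]; abel)
      (fun _ _ _ => by simp only [map_smul, lie_smul, map_sub, smul_sub]),
    fun x => by simp⟩

lemma incl_cochainOf (s : L →ₗ[k] E) (hs : ∀ x, X.proj (s x) = x) (x y : L) :
    X.incl (X.cochainOf s x y) = ⁅s x, s y⁆ - s ⁅x, y⁆ :=
  X.incl_toM (by simp [hs])

lemma cochainOf_mem (s : L →ₗ[k] E) (hs : ∀ x, X.proj (s x) = x) :
    X.cochainOf s ∈ twoCocycle k L M := by
  rw [mem_twoCocycle_iff]
  ext x y z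
  apply X.incl_injective
  have act : ∀ (a : L) (m : M), X.incl ⁅a, m⁆ = ⁅s a, X.incl m⁆ := fun a m => by
    rw [X.lie_incl, hs]
  simp only [d₂₃_apply, map_sub, map_add, act, LinearMap.zero_apply, map_zero,
    X.incl_cochainOf s hs, lie_sub]
  have j1 : ⁅s x, ⁅s y, s z⁆⁆ = ⁅⁅s x, s y⁆, s z⁆ + ⁅s y, ⁅s x, s z⁆⁆ := leibniz_lie _ _ _
  have j2 : s ⁅x, ⁅y, z⁆⁆ = s ⁅⁅x, y⁆, z⁆ + s ⁅y, ⁅x, z⁆⁆ := by rw [leibniz_lie x, map_add]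
  have k1 : ⁅s z, ⁅s x, s y⁆⁆ = - ⁅⁅s x, s y⁆, s z⁆ := (lie_skew _ _).symm
  have k2 : s ⁅⁅x, z⁆, y⁆ = - s ⁅y, ⁅x, z⁆⁆ := by rw [← lie_skew, map_neg]
  have k3 : s ⁅⁅y, z⁆, x⁆ = - s ⁅x, ⁅y, z⁆⁆ := by rw [← lie_skew, map_neg]
  have k4 : ∀ a b c : L, ⁅s ⁅a, b⁆, s c⁆ = - ⁅s c, s ⁅a, b⁆⁆ := fun _ _ _ => (lie_skew _ _).symm
  rw [k1, k2, k3, j1, j2, k4 x y z, k4 x z y, k4 y z x]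
  abel

/-- The 2-cocycle `f (x, y) = [s x, s y] - s [x, y]` of an extension with a linear section `s`. -/
noncomputable def cocycleOf (s : L →ₗ[k] E) (hs : ∀ x, X.proj (s x) = x) : twoCocycle k L M :=
  ⟨X.cochainOf s, X.cochainOf_mem s hs⟩

lemma exists_section : ∃ s : L →ₗ[k] E, ∀ x, X.proj (s x) = x := by
  obtain ⟨s, hs⟩ := LinearMap.exists_rightInverse_of_surjective (X.proj : E →ₗ[k] L)
    (LinearMap.range_eq_top.2 X.proj_surjective)
  exact ⟨s, fun x => LinearMap.congr_fun hs x⟩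

/-- The class of an extension in `H²(L, M)`. -/
noncomputable def cls : H2 k L M :=
  H2.mk k L M (X.cocycleOf X.exists_section.choose X.exists_section.choose_spec)

end ModExt

/-- A crossed extension `0 → M → 𝔪 → 𝔫 → L → 0` of the Lie algebra `L` by the `L`-module `M`:
an exact sequence whose middle map `bd` is a crossed module of Lie algebras, such that the
induced action of `L` on `M` is the given one. -/
structure CrossedExt (k L M 𝔪 𝔫 : Type*) [Field k] [LieRing L] [LieAlgebra k L]
    [AddCommGroup M] [Module k M] [LieRingModule L M] [LieModule k L M]
    [LieRing 𝔪] [LieAlgebra k 𝔪] [LieRing 𝔫] [LieAlgebra k 𝔫] where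
  /-- the inclusion of `M` -/
  incl : M →ₗ[k] 𝔪
  /-- the boundary map -/
  bd : 𝔪 →ₗ⁅k⁆ 𝔫
  /-- the action of `𝔫` on `𝔪` by derivations -/
  act : 𝔫 →ₗ⁅k⁆ LieDerivation k 𝔪 𝔪
  /-- the projection onto `L` -/
  proj : 𝔫 →ₗ⁅k⁆ L
  bd_act : ∀ (n : 𝔫) (m : 𝔪), bd (act n m) = ⁅n, bd m⁆
  act_bd : ∀ m m' : 𝔪, act (bd m) m' = ⁅m, m'⁆
  incl_injective : Function.Injective incl
  exact_left : ∀ m : 𝔪, bd m = 0 ↔ ∃ v, incl v = m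
  exact_right : ∀ n : 𝔫, proj n = 0 ↔ ∃ m, bd m = n
  proj_surjective : Function.Surjective proj
  act_incl : ∀ (n : 𝔫) (v : M), act n (incl v) = incl ⁅proj n, v⁆

namespace CrossedExt

variable {𝔪 𝔫 : Type*} [LieRing 𝔪] [LieAlgebra k 𝔪] [LieRing 𝔫] [LieAlgebra k 𝔫]
  (X : CrossedExt k L M 𝔪 𝔫)

lemma exists_retraction : ∃ r : 𝔪 →ₗ[k] M, r ∘ₗ X.incl = LinearMap.id :=
  LinearMap.exists_leftInverse_of_injective _ (LinearMap.ker_eq_bot.2 X.incl_injective)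

/-- A linear retraction of the inclusion; it is only applied to elements of the image of `M`,
where it is the inverse of the inclusion. -/
noncomputable def toM : 𝔪 →ₗ[k] M := X.exists_retraction.choose

@[simp] lemma toM_incl (m : M) : X.toM (X.incl m) = m :=
  LinearMap.congr_fun X.exists_retraction.choose_spec m

lemma incl_toM {e : 𝔪} (he : X.bd e = 0) : X.incl (X.toM e) = e := by
  obtain ⟨m, rfl⟩ := (X.exact_left e).1 he
  rw [toM_incl]

lemma exists_section : ∃ s : L →ₗ[k] 𝔫, ∀ x, X.proj (s x) = x := by
  obtain ⟨s, hs⟩ := LinearMap.exists_rightInverse_of_surjective (X.proj : 𝔫 →ₗ[k] L)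
    (LinearMap.range_eq_top.2 X.proj_surjective)
  exact ⟨s, fun x => LinearMap.congr_fun hs x⟩

/-- For every linear section `s` of `proj` the curvature `[s x, s y] - s [x, y]` lifts along `bd`
to an alternating bilinear map with values in `𝔪`. -/
lemma exists_lift (s : L →ₗ[k] 𝔫) (hs : ∀ x, X.proj (s x) = x) :
    ∃ F : twoCochain k L 𝔪, ∀ x y, X.bd (F x y) = ⁅s x, s y⁆ - s ⁅x, y⁆ := by
  obtain ⟨t, ht⟩ := LinearMap.exists_rightInverse_of_surjective
    (X.bd : 𝔪 →ₗ[k] 𝔫).rangeRestrict (LinearMap.range_rangeRestrict _)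
  obtain ⟨σ, hσ⟩ := LinearMap.exists_extend t
  have key : ∀ n : 𝔫, X.proj n = 0 → X.bd (σ n) = n := fun n hn => by
    obtain ⟨m, rfl⟩ := (X.exact_right n).1 hn
    have h1 := LinearMap.congr_fun hσ ⟨X.bd m, ⟨m, rfl⟩⟩
    have h2 := congrArg Subtype.val (LinearMap.congr_fun ht ⟨X.bd m, ⟨m, rfl⟩⟩)
    simp only [LinearMap.comp_apply, Submodule.subtype_apply] at h1
    rw [h1]
    exact h2
  refine ⟨⟨LinearMap.mk₂ k (fun x y => σ (⁅s x, s y⁆ - s ⁅x, y⁆))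
      (fun _ _ _ => by simp only [map_add, add_lie, map_sub]; abel)
      (fun _ _ _ => by simp only [map_smul, smul_lie, map_sub, smul_sub])
      (fun _ _ _ => by simp only [map_add, lie_add, map_sub]; abel)
      (fun _ _ _ => by simp only [map_smul, lie_smul, map_sub, smul_sub]),
    fun x => by simp⟩, fun x y => key _ (by simp [hs])⟩

/-- The formal coboundary, with `L` acting on `𝔪` through the section `s`, of a lift `F` of the
curvature of `s`. -/
noncomputable def formal (s : L →ₗ[k] 𝔫) (F : twoCochain k L 𝔪) (x y z : L) : 𝔪 :=
  X.act (s x) (F y z) - X.act (s y) (F x z) + X.act (s z) (F x y)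
    - F ⁅x, y⁆ z + F ⁅x, z⁆ y - F ⁅y, z⁆ x

lemma bd_formal (s : L →ₗ[k] 𝔫) (F : twoCochain k L 𝔪)
    (hF : ∀ x y, X.bd (F x y) = ⁅s x, s y⁆ - s ⁅x, y⁆) (x y z : L) :
    X.bd (X.formal s F x y z) = 0 := by
  simp only [formal, map_sub, map_add, X.bd_act, hF, lie_sub]
  have j1 : ⁅s x, ⁅s y, s z⁆⁆ = ⁅⁅s x, s y⁆, s z⁆ + ⁅s y, ⁅s x, s z⁆⁆ := leibniz_lie _ _ _
  have j2 : s ⁅x, ⁅y, z⁆⁆ = s ⁅⁅x, y⁆, z⁆ + s ⁅y, ⁅x, z⁆⁆ := by rw [leibniz_lie x, map_add]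
  have k1 : ⁅s z, ⁅s x, s y⁆⁆ = - ⁅⁅s x, s y⁆, s z⁆ := (lie_skew _ _).symm
  have k2 : s ⁅⁅x, z⁆, y⁆ = - s ⁅y, ⁅x, z⁆⁆ := by rw [← lie_skew, map_neg]
  have k3 : s ⁅⁅y, z⁆, x⁆ = - s ⁅x, ⁅y, z⁆⁆ := by rw [← lie_skew, map_neg]
  have k4 : ∀ a b c : L, ⁅s ⁅a, b⁆, s c⁆ = - ⁅s c, s ⁅a, b⁆⁆ := fun _ _ _ => (lie_skew _ _).symm
  rw [k1, k2, k3, j1, j2, k4 x y z, k4 x z y, k4 y z x]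
  abel

/-- The trilinear map with values in `M` given by the formal coboundary of `F`. -/
noncomputable def cochainOf (s : L →ₗ[k] 𝔫) (F : twoCochain k L 𝔪) :
    L →ₗ[k] L →ₗ[k] L →ₗ[k] M where
  toFun x := LinearMap.mk₂ k (fun y z => X.toM (X.formal s F x y z))
    (fun _ _ _ => by
      rw [← map_add]; congr 1
      simp only [formal, map_add, lie_add, add_lie, LinearMap.add_apply, LieDerivation.add_apply]
      abel)
    (fun _ _ _ => by
      rw [← map_smul]; congr 1
      simp only [formal, map_smul, lie_smul, smul_lie, LinearMap.smul_apply,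
        LieDerivation.smul_apply, smul_add, smul_sub])
    (fun _ _ _ => by
      rw [← map_add]; congr 1
      simp only [formal, map_add, lie_add, add_lie, LinearMap.add_apply, LieDerivation.add_apply]
      abel)
    (fun _ _ _ => by
      rw [← map_smul]; congr 1
      simp only [formal, map_smul, lie_smul, smul_lie, LinearMap.smul_apply,
        LieDerivation.smul_apply, smul_add, smul_sub])
  map_add' _ _ := by
    ext y z
    simp only [LinearMap.mk₂_apply, LinearMap.add_apply]
    rw [← map_add]; congr 1
    simp only [formal, map_add, lie_add, add_lie, LinearMap.add_apply, LieDerivation.add_apply]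
    abel
  map_smul' _ _ := by
    ext y z
    simp only [LinearMap.mk₂_apply, LinearMap.smul_apply, RingHom.id_apply]
    rw [← map_smul]; congr 1
    simp only [formal, map_smul, lie_smul, smul_lie, LinearMap.smul_apply,
      LieDerivation.smul_apply, smul_add, smul_sub]

lemma incl_cochainOf (s : L →ₗ[k] 𝔫) (F : twoCochain k L 𝔪)
    (hF : ∀ x y, X.bd (F x y) = ⁅s x, s y⁆ - s ⁅x, y⁆) (x y z : L) :
    X.incl (X.cochainOf s F x y z) = X.formal s F x y z :=
  X.incl_toM (X.bd_formal s F hF x y z)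

lemma cochainOf_mem (s : L →ₗ[k] 𝔫) (hs : ∀ x, X.proj (s x) = x) (F : twoCochain k L 𝔪)
    (hF : ∀ x y, X.bd (F x y) = ⁅s x, s y⁆ - s ⁅x, y⁆) :
    X.cochainOf s F ∈ threeCocycle k L M := by
  have sk : ∀ a b : L, F b a = - F a b := fun a b => (twoCochain_skew F a b).symm
  refine ⟨fun x y => ?_, fun x y => ?_, fun w x y z => ?_⟩
  · apply X.incl_injective
    rw [X.incl_cochainOf s F hF]
    simp [formal, sk x ⁅x, y⁆]
  · apply X.incl_injective
    rw [X.incl_cochainOf s F hF]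
    simp [formal]
  · apply X.incl_injective
    have act : ∀ (a : L) (m : M), X.incl ⁅a, m⁆ = X.act (s a) (X.incl m) := fun a m => by
      rw [X.act_incl, hs]
    have comm : ∀ (a b : L) (m : 𝔪), X.act (s a) (X.act (s b) m) =
        X.act (s b) (X.act (s a) m) + ⁅F a b, m⁆ + X.act (s ⁅a, b⁆) m := fun a b m => by
      have h1 : X.act ⁅s a, s b⁆ m = X.act (s a) (X.act (s b) m) - X.act (s b) (X.act (s a) m) := by
        rw [LieHom.map_lie, LieDerivation.lie_apply]
      have h2 : ⁅s a, s b⁆ = X.bd (F a b) + s ⁅a, b⁆ := by rw [hF]; abel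
      rw [h2, map_add, LieDerivation.add_apply, X.act_bd] at h1
      rw [add_assoc, h1]
      abel
    simp only [map_sub, map_add, act, map_zero, X.incl_cochainOf s F hF, formal]
    have J : ∀ a b c d : L, F ⁅⁅a, b⁆, c⁆ d = F ⁅a, ⁅b, c⁆⁆ d - F ⁅b, ⁅a, c⁆⁆ d :=
      fun a b c d => by rw [lie_lie, map_sub, LinearMap.sub_apply]
    have K : ∀ a b c d : L, F ⁅⁅a, b⁆, c⁆ d = - F ⁅c, ⁅a, b⁆⁆ d :=
      fun a b c d => by rw [← lie_skew, map_neg, LinearMap.neg_apply]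
    rw [comm w x (F y z), comm w y (F x z), comm w z (F x y), comm x y (F w z),
      comm x z (F w y), comm y z (F w x),
      J w x y z, K w y x z, K x y w z, J w x z y, K w z x y, K x z w y,
      J w y z x, K w z y x, K y z w x, J x y z w, K x z y w, K y z x w,
      sk ⁅w, x⁆ ⁅y, z⁆, sk ⁅w, y⁆ ⁅x, z⁆, sk ⁅w, z⁆ ⁅x, y⁆,
      ← lie_skew (F x y) (F w z), ← lie_skew (F x z) (F w y), ← lie_skew (F y z) (F w x)]
    abel

/-- The 3-cocycle of a crossed extension associated with a linear section `s` and a lift `F` of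
its curvature. -/
noncomputable def cocycleOf (s : L →ₗ[k] 𝔫) (hs : ∀ x, X.proj (s x) = x) (F : twoCochain k L 𝔪)
    (hF : ∀ x y, X.bd (F x y) = ⁅s x, s y⁆ - s ⁅x, y⁆) : threeCocycle k L M :=
  ⟨X.cochainOf s F, X.cochainOf_mem s hs F hF⟩

/-- The class of a crossed extension in `H³(L, M)`. -/
noncomputable def cls : H3 k L M :=
  H3.mk k L M (X.cocycleOf X.exists_section.choose X.exists_section.choose_spec
    (X.exists_lift _ X.exists_section.choose_spec).choose
    (X.exists_lift _ X.exists_section.choose_spec).choose_spec)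

end CrossedExt

end Extensions

section Ideal

variable {k g M : Type*} [Field k] [LieRing g] [LieAlgebra k g]
  [AddCommGroup M] [Module k M] [LieRingModule g M] [LieModule k g M] (h : LieIdeal k g)

/-- The action `(x · d) z = x · d z - d [x, z]` of `g` on the derivations from an ideal `h` of `g`
to a `g`-module. -/
def derAct (x : g) (d : LieDerivation k h M) : LieDerivation k h M where
  toLinearMap :=
    { toFun := fun z => ⁅x, d z⁆ - d ⁅x, z⁆
      map_add' := fun a b => by simp only [map_add, lie_add]; abel
      map_smul' := fun t a => by simp only [map_smul, lie_smul, smul_sub, RingHom.id_apply] }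
  leibniz' a b := by
    have e : ∀ (z : h) (m : M), ⁅z, m⁆ = ⁅(z : g), m⁆ := fun _ _ => rfl
    have e1 : ⁅x, ⁅a, b⁆⁆ = ⁅⁅x, a⁆, b⁆ + ⁅a, ⁅x, b⁆⁆ := by
      apply Subtype.ext
      simp
    simp only [LinearMap.coe_mk, AddHom.coe_mk, e1, map_add, LieDerivation.apply_lie_eq_sub,
      lie_sub, e, LieSubmodule.coe_bracket, lie_lie]
    abel

instance : LieRingModule g (LieDerivation k h M) where
  bracket x d := derAct h x d
  add_lie x y d := by
    ext z
    change ⁅x + y, d z⁆ - d ⁅x + y, z⁆ = (⁅x, d z⁆ - d ⁅x, z⁆) + (⁅y, d z⁆ - d ⁅y, z⁆)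
    simp only [add_lie, map_add]
    abel
  lie_add x d d' := by
    ext z
    change ⁅x, (d + d') z⁆ - (d + d') ⁅x, z⁆ = (⁅x, d z⁆ - d ⁅x, z⁆) + (⁅x, d' z⁆ - d' ⁅x, z⁆)
    simp only [LieDerivation.add_apply, lie_add]
    abel
  leibniz_lie x y d := by
    ext z
    change ⁅x, ⁅y, d z⁆ - d ⁅y, z⁆⁆ - (⁅y, d ⁅x, z⁆⁆ - d ⁅y, ⁅x, z⁆⁆) =
      (⁅⁅x, y⁆, d z⁆ - d ⁅⁅x, y⁆, z⁆) + (⁅y, ⁅x, d z⁆ - d ⁅x, z⁆⁆ - (⁅x, d ⁅y, z⁆⁆ - d ⁅x, ⁅y, z⁆⁆))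
    simp only [lie_sub, lie_lie, map_sub]
    abel

@[simp] lemma lie_der_apply (x : g) (d : LieDerivation k h M) (z : h) :
    ⁅x, d⁆ z = ⁅x, d z⁆ - d ⁅x, z⁆ := rfl

instance : LieModule k g (LieDerivation k h M) where
  smul_lie t x d := by
    ext z
    simp [smul_sub]
  lie_smul t x d := by
    ext z
    simp [smul_sub]

lemma lie_inner (x : g) (m : M) :
    ⁅x, LieDerivation.inner k h M m⁆ = LieDerivation.inner k h M ⁅x, m⁆ := by
  ext z
  change ⁅x, ⁅(z : g), m⁆⁆ - ⁅⁅x, (z : g)⁆, m⁆ = ⁅(z : g), ⁅x, m⁆⁆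
  rw [lie_lie]
  abel

lemma mem_lie_der (z : g) (hz : z ∈ h) (d : LieDerivation k h M) :
    ⁅z, d⁆ = LieDerivation.inner k h M (d ⟨z, hz⟩) := by
  ext w
  change ⁅z, d w⁆ - d ⁅z, w⁆ = ⁅(w : g), d ⟨z, hz⟩⁆
  have e1 : ⁅z, w⁆ = ⁅(⟨z, hz⟩ : h), w⁆ := rfl
  rw [e1, LieDerivation.apply_lie_eq_sub]
  exact sub_sub_cancel _ _

/-- The action of `g` on `H¹(h, M)` as a linear map `g → End (H¹(h, M))`. -/
def h1ActAux : g →ₗ[k] Module.End k (H1 k h M) where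
  toFun x := Submodule.mapQ _ _ (LieModule.toEnd k g (LieDerivation k h M) x) (by
    rintro _ ⟨m, rfl⟩
    exact ⟨⁅x, m⁆, (lie_inner h x m).symm⟩)
  map_add' x y := by
    apply LinearMap.ext
    intro c
    obtain ⟨d, rfl⟩ := Submodule.Quotient.mk_surjective _ c
    exact congrArg (H1.mk k h M) (add_lie x y d)
  map_smul' t x := by
    apply LinearMap.ext
    intro c
    obtain ⟨d, rfl⟩ := Submodule.Quotient.mk_surjective _ c
    exact congrArg (H1.mk k h M) (smul_lie t x d)

/-- The action of `g ⧸ h` on `H¹(h, M)` induced by the action of `g` on derivations. -/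
def h1Act : (g ⧸ h) →ₗ[k] Module.End k (H1 k h M) :=
  Submodule.liftQ h.toSubmodule (h1ActAux h) (by
    intro z hz
    rw [LinearMap.mem_ker]
    apply LinearMap.ext
    intro c
    obtain ⟨d, rfl⟩ := Submodule.Quotient.mk_surjective _ c
    refine (Submodule.Quotient.mk_eq_zero _).2 ?_
    exact ⟨_, (mem_lie_der h z hz d).symm⟩)

instance : LieRingModule (g ⧸ h) (H1 k h M) where
  bracket x c := h1Act h x c
  add_lie x y c := by simp
  lie_add x c c' := by simp
  leibniz_lie x y c := by
    obtain ⟨x, rfl⟩ := Submodule.Quotient.mk_surjective _ x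
    obtain ⟨y, rfl⟩ := Submodule.Quotient.mk_surjective _ y
    obtain ⟨d, rfl⟩ := Submodule.Quotient.mk_surjective _ c
    exact congrArg (H1.mk k h M) (leibniz_lie x y d)

instance : LieModule k (g ⧸ h) (H1 k h M) where
  smul_lie t x c := by
    change h1Act h (t • x) c = t • h1Act h x c
    simp
  lie_smul t x c := by
    change h1Act h x (t • c) = t • h1Act h x c
    simp

@[simp] lemma mk_lie_h1 (x : g) (d : LieDerivation k h M) :
    ⁅(LieSubmodule.Quotient.mk x : g ⧸ h), H1.mk k h M d⁆ = H1.mk k h M ⁅x, d⁆ := rfl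

variable (M) in
/-- The invariants `M^h`. -/
abbrev Inv : LieSubmodule k h M := LieModule.maxTrivSubmodule k h M

/-- The action of `g` on `M^h`. -/
def invActAux : g →ₗ[k] Module.End k (Inv M h) where
  toFun x := (LieModule.toEnd k g M x).restrict (p := (Inv M h).toSubmodule)
    (q := (Inv M h).toSubmodule) (fun m hm z => by
      have e : ∀ (z : h) (m : M), ⁅z, m⁆ = ⁅(z : g), m⁆ := fun _ _ => rfl
      have h1 : ⁅(z : g), m⁆ = 0 := hm z
      have h2 : ⁅⁅(z : g), x⁆, m⁆ = 0 := hm ⟨⁅(z : g), x⁆, lie_mem_left k g h _ _ z.2⟩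
      rw [e, LieModule.toEnd_apply_apply, leibniz_lie, h1, h2]
      simp)
  map_add' x y := by
    ext m
    exact add_lie x y (m : M)
  map_smul' t x := by
    ext m
    exact smul_lie t x (m : M)

/-- The action of `g ⧸ h` on `M^h`. -/
def invAct : (g ⧸ h) →ₗ[k] Module.End k (Inv M h) :=
  Submodule.liftQ h.toSubmodule (invActAux h) (by
    intro z hz
    rw [LinearMap.mem_ker]
    ext m
    exact m.2 ⟨z, hz⟩)

instance : LieRingModule (g ⧸ h) (Inv M h) where
  bracket x c := invAct h x c
  add_lie x y c := by simp
  lie_add x c c' := by simp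
  leibniz_lie x y m := by
    obtain ⟨x, rfl⟩ := Submodule.Quotient.mk_surjective _ x
    obtain ⟨y, rfl⟩ := Submodule.Quotient.mk_surjective _ y
    apply Subtype.ext
    exact leibniz_lie x y (m : M)

instance : LieModule k (g ⧸ h) (Inv M h) where
  smul_lie t x c := by
    change invAct h (t • x) c = t • invAct h x c
    simp
  lie_smul t x c := by
    change invAct h x (t • c) = t • invAct h x c
    simp

@[simp] lemma coe_mk_lie_inv (x : g) (m : Inv M h) :
    ((⁅(LieSubmodule.Quotient.mk x : g ⧸ h), m⁆ : Inv M h) : M) = ⁅x, (m : M)⁆ := rfl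

/-- The projection `g → g ⧸ h` as a Lie algebra map. -/
def quotMk : g →ₗ⁅k⁆ g ⧸ h :=
  { h.toSubmodule.mkQ with map_lie' := fun {_ _} => rfl }

@[simp] lemma quotMk_apply (x : g) : quotMk h x = LieSubmodule.Quotient.mk x := rfl

variable {h} in
lemma quotMk_eq_zero {x : g} : quotMk h x = 0 ↔ x ∈ h := Submodule.Quotient.mk_eq_zero _

/-! ### Partially split extensions -/

section PartialSplitting

variable {h} {E : Type*} [LieRing E] [LieAlgebra k E] (X : ModExt k g M E)
  (s : h →ₗ⁅k⁆ E) (hs : ∀ z : h, X.proj (s z) = z)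

lemma ModExt.incl_defect_aux (hs : ∀ z : h, X.proj (s z) = z) (x : E) (z : h) :
    X.incl (X.toM (⁅x, s z⁆ - s ⁅X.proj x, z⁆)) = ⁅x, s z⁆ - s ⁅X.proj x, z⁆ :=
  X.incl_toM (by simp [hs])

/-- For a partial splitting `s : h → E` of an extension and `x : E`, the derivation
`z ↦ [x, s z] - s [p x, z]` from `h` to `M`. -/
noncomputable def ModExt.defect : E →ₗ[k] LieDerivation k h M where
  toFun x :=
    { toLinearMap :=
        { toFun := fun z => X.toM (⁅x, s z⁆ - s ⁅X.proj x, z⁆)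
          map_add' := fun a b => by simp only [map_add, lie_add, map_sub]; abel
          map_smul' := fun t a => by
            simp only [map_smul, lie_smul, map_sub, smul_sub, RingHom.id_apply] }
      leibniz' := fun a b => by
        apply X.incl_injective
        have e : ∀ (z : h) (m : M), X.incl ⁅z, m⁆ = ⁅s z, X.incl m⁆ := fun z m => by
          rw [X.lie_incl, hs]
          rfl
        have e1 : ⁅X.proj x, ⁅a, b⁆⁆ = ⁅⁅X.proj x, a⁆, b⁆ + ⁅a, ⁅X.proj x, b⁆⁆ := by
          apply Subtype.ext
          simp
        simp only [LinearMap.coe_mk, AddHom.coe_mk, map_sub X.incl, e]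
        have l1 : ⁅⁅x, s a⁆, s b⁆ = - ⁅s b, ⁅x, s a⁆⁆ := (lie_skew _ _).symm
        have l2 : ⁅s ⁅X.proj x, a⁆, s b⁆ = - ⁅s b, s ⁅X.proj x, a⁆⁆ := (lie_skew _ _).symm
        rw [X.incl_defect_aux s hs, X.incl_defect_aux s hs, X.incl_defect_aux s hs, e1,
          map_add, LieHom.map_lie, LieHom.map_lie, LieHom.map_lie, leibniz_lie x, l1, l2]
        simp only [lie_sub]
        abel }
  map_add' x y := by
    ext z
    change X.toM (⁅x + y, s z⁆ - s ⁅X.proj (x + y), z⁆) = X.toM (⁅x, s z⁆ - s ⁅X.proj x, z⁆) +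
      X.toM (⁅y, s z⁆ - s ⁅X.proj y, z⁆)
    simp only [map_add, add_lie, map_sub]
    abel
  map_smul' t x := by
    ext z
    change X.toM (⁅t • x, s z⁆ - s ⁅X.proj (t • x), z⁆) = t • X.toM (⁅x, s z⁆ - s ⁅X.proj x, z⁆)
    simp only [map_smul, smul_lie, map_sub, smul_sub]

lemma ModExt.incl_defect (x : E) (z : h) :
    X.incl (X.defect s hs x z) = ⁅x, s z⁆ - s ⁅X.proj x, z⁆ :=
  X.incl_defect_aux s hs x z

/-- The largest subalgebra of `E` in which the image of `s` is an ideal. -/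
abbrev idealizer : LieSubalgebra k E := s.range.normalizer

/-- The image of `s` as an ideal of that subalgebra. -/
def rangeIdeal : LieIdeal k (idealizer s) where
  carrier := {x | (x : E) ∈ s.range}
  add_mem' ha hb := s.range.add_mem ha hb
  zero_mem' := s.range.zero_mem
  smul_mem' t _ ha := s.range.smul_mem t ha
  lie_mem {x} {_} hm := (LieSubalgebra.mem_normalizer_iff _ _).1 x.2 _ hm

lemma ModExt.eq_zero_of_incl_mem (hs : ∀ z : h, X.proj (s z) = z) {m : M}
    (hm : X.incl m ∈ s.range) : m = 0 := by
  obtain ⟨z, hz⟩ := hm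
  replace hz : s z = X.incl m := hz
  have h0 : (z : g) = 0 := by rw [← hs z, hz, X.proj_incl]
  have h1 : z = 0 := Subtype.ext h0
  apply X.incl_injective
  rw [← hz, h1, map_zero, map_zero]

lemma ModExt.lie_incl_split (hs : ∀ z : h, X.proj (s z) = z) (m : M) (z : h) :
    ⁅X.incl m, s z⁆ = - X.incl ⁅z, m⁆ := by
  rw [← lie_skew, X.lie_incl, hs]
  rfl

lemma ModExt.incl_mem_idealizer (hs : ∀ z : h, X.proj (s z) = z) (m : M) :
    X.incl m ∈ idealizer s ↔ m ∈ Inv M h := by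
  rw [LieSubalgebra.mem_normalizer_iff, LieModule.mem_maxTrivSubmodule]
  constructor
  · intro H z
    have h1 := H (s z) ⟨z, rfl⟩
    rw [X.lie_incl_split s hs, ← map_neg] at h1
    exact neg_eq_zero.1 (X.eq_zero_of_incl_mem s hs h1)
  · rintro H _ ⟨z, rfl⟩
    change ⁅X.incl m, s z⁆ ∈ s.range
    rw [X.lie_incl_split s hs, H z, map_zero, neg_zero]
    exact s.range.zero_mem

/-- The extension `0 → M^h → I ⧸ s(h) → g ⧸ h → 0` obtained from a partial splitting `s` all of
whose defect derivations are inner, where `I` is the idealizer of `s(h)`. -/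
def ModExt.omega (hin : ∀ x, X.defect s hs x ∈ LinearMap.range (LieDerivation.inner k h M)) :
    ModExt k (g ⧸ h) (Inv M h) (idealizer s ⧸ rangeIdeal s) where
  incl :=
    { toFun := fun m => LieSubmodule.Quotient.mk
        (⟨X.incl m, (X.incl_mem_idealizer s hs m).2 m.2⟩ : idealizer s)
      map_add' := fun a b => congrArg LieSubmodule.Quotient.mk
        (Subtype.ext (map_add X.incl (a : M) (b : M)))
      map_smul' := fun t a => congrArg LieSubmodule.Quotient.mk
        (Subtype.ext (map_smul X.incl t (a : M))) }
  proj :=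
    { Submodule.liftQ (rangeIdeal s).toSubmodule
        (((quotMk h).comp (X.proj.comp (idealizer s).incl) : idealizer s →ₗ⁅k⁆ g ⧸ h) :
          idealizer s →ₗ[k] g ⧸ h) (by
          rintro u ⟨z, hz⟩
          refine (Submodule.Quotient.mk_eq_zero _).2 ?_
          change X.proj (u : E) ∈ h
          rw [← hz]
          exact (hs z).symm ▸ z.2) with
      map_lie' := by
        intro u v
        obtain ⟨u, rfl⟩ := Submodule.Quotient.mk_surjective _ u
        obtain ⟨v, rfl⟩ := Submodule.Quotient.mk_surjective _ v
        exact LieHom.map_lie ((quotMk h).comp (X.proj.comp (idealizer s).incl)) u v }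
  incl_injective := by
    rw [injective_iff_map_eq_zero]
    intro m hm
    have h1 := (Submodule.Quotient.mk_eq_zero (rangeIdeal s).toSubmodule).1 hm
    exact Subtype.ext (X.eq_zero_of_incl_mem s hs h1)
  proj_surjective := by
    intro x
    obtain ⟨x, rfl⟩ := Submodule.Quotient.mk_surjective _ x
    obtain ⟨e, rfl⟩ := X.proj_surjective x
    obtain ⟨m, hm⟩ := hin e
    refine ⟨LieSubmodule.Quotient.mk (⟨e + X.incl m, ?_⟩ : idealizer s), ?_⟩
    · rw [LieSubalgebra.mem_normalizer_iff]
      rintro _ ⟨z, rfl⟩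
      have h1 := X.incl_defect s hs e z
      rw [← hm, LieDerivation.inner_apply_apply] at h1
      refine ⟨⁅X.proj e, z⁆, ?_⟩
      change s ⁅X.proj e, z⁆ = ⁅e + X.incl m, s z⁆
      rw [add_lie, X.lie_incl_split s hs, h1]
      simp
    · change quotMk h (X.proj (e + X.incl m)) = quotMk h (X.proj e)
      rw [map_add, X.proj_incl, add_zero]
  exact := by
    intro u
    obtain ⟨u, rfl⟩ := Submodule.Quotient.mk_surjective _ u
    constructor
    · intro hu
      have h0 : X.proj (u : E) ∈ h := (Submodule.Quotient.mk_eq_zero _).1 hu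
      obtain ⟨m, hm⟩ := (X.exact ((u : E) - s ⟨_, h0⟩)).1 (by rw [map_sub, hs, sub_self])
      have h1 : s ⟨_, h0⟩ ∈ idealizer s := LieSubalgebra.le_normalizer _ ⟨_, rfl⟩
      have h2 : m ∈ Inv M h := by
        rw [← X.incl_mem_idealizer s hs, hm]
        exact sub_mem u.2 h1
      refine ⟨⟨m, h2⟩, ?_⟩
      refine (Submodule.Quotient.eq _).2 ?_
      change X.incl m - (u : E) ∈ s.range
      rw [hm, sub_sub_cancel_left]
      exact neg_mem ⟨_, rfl⟩
    · rintro ⟨m, hm⟩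
      rw [← hm]
      change quotMk h (X.proj (X.incl m)) = 0
      rw [X.proj_incl, map_zero]
  lie_incl := by
    intro u m
    obtain ⟨u, rfl⟩ := Submodule.Quotient.mk_surjective _ u
    exact congrArg LieSubmodule.Quotient.mk (Subtype.ext (X.lie_incl (u : E) (m : M)))

end PartialSplitting

/-! ### The extension of a 2-cocycle and semidirect products -/

section CocycleExt

variable {L N : Type*} [LieRing L] [LieAlgebra k L]
  [AddCommGroup N] [Module k N] [LieRingModule L N] [LieModule k L N]

/-- The extension of `L` by `N` with middle term `L × N` and bracket
`[(x, m), (y, n)] = ([x, y], f (x, y) + x · n - y · m)`. -/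
def cocycleExt (f : twoCocycle k L N) : ModExt k L N (LieAlgebra.ofTwoCocycle f) where
  incl :=
    { toFun := fun m => ⟨(0, m)⟩
      map_add' := fun a b => by
        change (⟨(0, a + b)⟩ : LieAlgebra.ofTwoCocycle f) = ⟨(0 + 0, a + b)⟩
        rw [add_zero]
      map_smul' := fun t a => by
        change (⟨(0, t • a)⟩ : LieAlgebra.ofTwoCocycle f) = ⟨(t • 0, t • a)⟩
        rw [smul_zero] }
  proj :=
    { toFun := fun e => e.carrier.1
      map_add' := fun _ _ => rfl
      map_smul' := fun _ _ => rfl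
      map_lie' := rfl }
  incl_injective a b hab := congrArg (fun e => e.carrier.2) hab
  proj_surjective x := ⟨⟨(x, 0)⟩, rfl⟩
  exact e := by
    constructor
    · intro he
      obtain ⟨x, m⟩ := e
      obtain rfl : x = 0 := he
      exact ⟨m, rfl⟩
    · rintro ⟨m, rfl⟩
      rfl
  lie_incl e m := by
    obtain ⟨x, n⟩ := e
    change (⟨(⁅x, (0 : L)⁆, f.1 x 0 + ⁅x, m⁆ - ⁅(0 : L), n⁆)⟩ : LieAlgebra.ofTwoCocycle f) =
      ⟨(0, ⁅x, m⁆)⟩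
    simp

/-- The semidirect product of a Lie algebra `L` and an `L`-module `N`: pairs `(x, n)` with the bracket
`[(x, m), (y, n)] = ([x, y], x · n - y · m)`. -/
@[ext] structure SemiProd (L N : Type*) where
  /-- the component in `L` -/
  fst : L
  /-- the component in `N` -/
  snd : N

namespace SemiProd

/-- The bijection with `L × N` through which sums and multiples are defined. -/
def equiv (L N : Type*) : SemiProd L N ≃ L × N where
  toFun e := (e.fst, e.snd)
  invFun e := ⟨e.1, e.2⟩

instance : AddCommGroup (SemiProd L N) := (equiv L N).addCommGroup

instance : Module k (SemiProd L N) := (equiv L N).module k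

lemma add_mk (x y : L) (m n : N) :
    (⟨x, m⟩ : SemiProd L N) + ⟨y, n⟩ = ⟨x + y, m + n⟩ := rfl

lemma sub_mk (x y : L) (m n : N) :
    (⟨x, m⟩ : SemiProd L N) - ⟨y, n⟩ = ⟨x - y, m - n⟩ := rfl

lemma smul_mk (t : k) (x : L) (m : N) : t • (⟨x, m⟩ : SemiProd L N) = ⟨t • x, t • m⟩ := rfl

lemma zero_def : (0 : SemiProd L N) = ⟨0, 0⟩ := rfl

instance : Bracket (SemiProd L N) (SemiProd L N) :=
  ⟨fun u v => ⟨⁅u.fst, v.fst⁆, ⁅u.fst, v.snd⁆ - ⁅v.fst, u.snd⁆⟩⟩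

lemma lie_mk (x y : L) (m n : N) :
    ⁅(⟨x, m⟩ : SemiProd L N), (⟨y, n⟩ : SemiProd L N)⁆ = ⟨⁅x, y⁆, ⁅x, n⁆ - ⁅y, m⁆⟩ := rfl

instance : LieRing (SemiProd L N) where
  add_lie := by
    rintro ⟨x, m⟩ ⟨y, n⟩ ⟨z, p⟩
    simp only [add_mk, lie_mk, add_lie, lie_add, SemiProd.mk.injEq, true_and]
    abel
  lie_add := by
    rintro ⟨x, m⟩ ⟨y, n⟩ ⟨z, p⟩
    simp only [add_mk, lie_mk, add_lie, lie_add, SemiProd.mk.injEq, true_and]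
    abel
  lie_self := by
    rintro ⟨x, m⟩
    simp only [lie_mk, lie_self, sub_self, zero_def]
  leibniz_lie := by
    rintro ⟨x, m⟩ ⟨y, n⟩ ⟨z, p⟩
    simp only [add_mk, lie_mk, lie_sub, lie_lie, SemiProd.mk.injEq]
    constructor <;> abel

instance : LieAlgebra k (SemiProd L N) where
  lie_smul := by
    rintro t ⟨x, m⟩ ⟨y, n⟩
    simp only [smul_mk, lie_mk, lie_smul, smul_lie, smul_sub]

end SemiProd

variable (k L N) in
/-- The standard split extension of `L` by `N`. -/
def splitExt : ModExt k L N (SemiProd L N) where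
  incl :=
    { toFun := fun m => ⟨0, m⟩
      map_add' := fun a b => by rw [SemiProd.add_mk, add_zero]
      map_smul' := fun t a => by rw [SemiProd.smul_mk, smul_zero, RingHom.id_apply] }
  proj :=
    { toFun := fun e => e.fst
      map_add' := fun _ _ => rfl
      map_smul' := fun _ _ => rfl
      map_lie' := rfl }
  incl_injective a b hab := congrArg SemiProd.snd hab
  proj_surjective x := ⟨⟨x, 0⟩, rfl⟩
  exact e := by
    constructor
    · intro he
      exact ⟨e.snd, SemiProd.ext he.symm rfl⟩
    · rintro ⟨m, rfl⟩
      rfl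
  lie_incl e m := by
    obtain ⟨x, n⟩ := e
    change ⁅(⟨x, n⟩ : SemiProd L N), (⟨0, m⟩ : SemiProd L N)⁆ = ⟨0, ⁅x, m⁆⟩
    rw [SemiProd.lie_mk, lie_zero, zero_lie, sub_zero]

end CocycleExt

/-! ### The map `tr` -/

/-- The partial splitting `z ↦ (z, d z)` of the standard split extension given by a derivation. -/
def splitOf (d : LieDerivation k h M) : h →ₗ⁅k⁆ SemiProd g M where
  toFun z := ⟨(z : g), d z⟩
  map_add' a b := by
    rw [map_add]
    rfl
  map_smul' t a := by
    rw [map_smul]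
    rfl
  map_lie' {a b} := by
    rw [SemiProd.lie_mk, LieDerivation.apply_lie_eq_sub]
    rfl

lemma proj_splitOf (d : LieDerivation k h M) (z : h) :
    (splitExt k g M).proj (splitOf h d z) = z := rfl

variable (M) in
/-- `H¹(h, M)^(g ⧸ h)`. -/
abbrev InvH1 : LieSubmodule k (g ⧸ h) (H1 k h M) :=
  LieModule.maxTrivSubmodule k (g ⧸ h) (H1 k h M)

/-- If `[d]` is invariant then all defects of the partial splitting given by `d` are inner. -/
lemma defect_splitOf_inner (d : LieDerivation k h M) (hd : H1.mk k h M d ∈ InvH1 M h)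
    (e : SemiProd g M) :
    (splitExt k g M).defect (splitOf h d) (proj_splitOf h d) e ∈
      LinearMap.range (LieDerivation.inner k h M) := by
  obtain ⟨x, m⟩ := e
  have h1 : H1.mk k h M ⁅x, d⁆ = 0 := by
    rw [← mk_lie_h1]
    exact hd _
  obtain ⟨n, hn⟩ := H1.mk_eq_zero.1 h1
  refine ⟨n - m, ?_⟩
  rw [map_sub, hn]
  ext z
  apply (splitExt k g M).incl_injective
  rw [ModExt.incl_defect]
  change (⟨0, (⁅x, d z⁆ - d ⁅x, z⁆) - ⁅(z : g), m⁆⟩ : SemiProd g M) =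
    ⁅(⟨x, m⟩ : SemiProd g M), (⟨(z : g), d z⟩ : SemiProd g M)⁆ -
      (⟨⁅x, (z : g)⁆, d ⁅x, z⁆⟩ : SemiProd g M)
  rw [SemiProd.lie_mk]
  change _ = (⟨⁅x, (z : g)⁆ - ⁅x, (z : g)⁆, ⁅x, d z⁆ - ⁅(z : g), m⁆ - d ⁅x, z⁆⟩ :
    SemiProd g M)
  rw [sub_self, sub_right_comm]

/-- The class in `H²(g ⧸ h, M^h)` attached to a derivation `d` with invariant class. -/
noncomputable def trHat (d : LieDerivation k h M) (hd : H1.mk k h M d ∈ InvH1 M h) :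
    H2 k (g ⧸ h) (Inv M h) :=
  ((splitExt k g M).omega (splitOf h d) (proj_splitOf h d) (defect_splitOf_inner h d hd)).cls

variable {h} in
lemma InvH1.exists_rep (c : InvH1 M h) :
    ∃ d : LieDerivation k h M, H1.mk k h M d = c := H1.exists_rep _

/-- `tr : H¹(h, M)^(g ⧸ h) → H²(g ⧸ h, M^h)`, computed with a derivation representing the class. -/
noncomputable def tr (c : InvH1 M h) : H2 k (g ⧸ h) (Inv M h) :=
  trHat h (InvH1.exists_rep c).choose (by
    rw [(InvH1.exists_rep c).choose_spec]
    exact c.2)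

/-! ### The map `ρ` -/

section Rho

variable {h} {E : Type*} [LieRing E] [LieAlgebra k E] (X : ModExt k g M E)
  (s : h →ₗ⁅k⁆ E) (hs : ∀ z : h, X.proj (s z) = z)

lemma defect_incl (m : M) : X.defect s hs (X.incl m) = - LieDerivation.inner k h M m := by
  ext z
  apply X.incl_injective
  rw [X.incl_defect, X.lie_incl_split s hs, X.proj_incl]
  simp

lemma defect_split (w : h) : X.defect s hs (s w) = 0 := by
  ext z
  apply X.incl_injective
  rw [X.incl_defect, hs]
  have e : ⁅(w : g), z⁆ = ⁅w, z⁆ := rfl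
  rw [e, LieHom.map_lie]
  simp

/-- The class of the defect of `x` only depends on the image of `x` in `g ⧸ h`. -/
lemma mk_defect_eq {x y : E} (hxy : quotMk h (X.proj x) = quotMk h (X.proj y)) :
    H1.mk k h M (X.defect s hs x) = H1.mk k h M (X.defect s hs y) := by
  have h1 : X.proj (x - y) ∈ h := by
    rw [map_sub]
    exact (Submodule.Quotient.eq _).1 hxy
  obtain ⟨m, hm⟩ := (X.exact (x - y - s ⟨_, h1⟩)).1 (by rw [map_sub, hs, sub_self])
  have h2 : x = y + X.incl m + s ⟨_, h1⟩ := by rw [hm]; abel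
  have h3 : X.defect s hs x = X.defect s hs y - LieDerivation.inner k h M m := by
    conv_lhs => rw [h2]
    rw [map_add, map_add, defect_split, defect_incl]
    abel
  rw [h3, map_sub, sub_eq_self]
  exact H1.mk_eq_zero.2 ⟨m, rfl⟩

lemma defect_lie (x y : E) : X.defect s hs ⁅x, y⁆ =
    ⁅X.proj x, X.defect s hs y⁆ - ⁅X.proj y, X.defect s hs x⁆ := by
  ext z
  apply X.incl_injective
  rw [LieDerivation.sub_apply, lie_der_apply, lie_der_apply]
  simp only [map_sub X.incl, ← X.lie_incl, X.incl_defect, LieHom.map_lie, lie_lie, lie_sub, map_sub]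
  abel

lemma exists_bisection : ∃ t : (g ⧸ h) →ₗ[k] E, ∀ x, quotMk h (X.proj (t x)) = x := by
  obtain ⟨t, ht⟩ := LinearMap.exists_rightInverse_of_surjective
    (((quotMk h).comp X.proj : E →ₗ⁅k⁆ g ⧸ h) : E →ₗ[k] g ⧸ h)
    (LinearMap.range_eq_top.2
      ((Submodule.Quotient.mk_surjective _).comp X.proj_surjective))
  exact ⟨t, fun x => LinearMap.congr_fun ht x⟩

/-- The derivation `g ⧸ h → H¹(h, M)` of a partially split extension: it maps the class of `p y`,
for `y : E`, to the class of the defect of `y`. -/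
noncomputable def rhoBar : LieDerivation k (g ⧸ h) (H1 k h M) where
  toLinearMap := H1.mk k h M ∘ₗ X.defect s hs ∘ₗ (exists_bisection (h := h) X).choose
  leibniz' x y := by
    have ht := (exists_bisection (h := h) X).choose_spec
    set t := (exists_bisection (h := h) X).choose
    change H1.mk k h M (X.defect s hs (t ⁅x, y⁆)) = ⁅x, H1.mk k h M (X.defect s hs (t y))⁆ -
      ⁅y, H1.mk k h M (X.defect s hs (t x))⁆
    have h1 : H1.mk k h M (X.defect s hs (t ⁅x, y⁆)) =
        H1.mk k h M (X.defect s hs ⁅t x, t y⁆) :=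
      mk_defect_eq X s hs (by rw [LieHom.map_lie, LieHom.map_lie, ht, ht, ht])
    rw [h1, defect_lie, map_sub, ← mk_lie_h1, ← mk_lie_h1]
    change ⁅quotMk h (X.proj (t x)), _⁆ - ⁅quotMk h (X.proj (t y)), _⁆ = _
    rw [ht, ht]

lemma rhoBar_apply (y : E) :
    rhoBar X s hs (quotMk h (X.proj y)) = H1.mk k h M (X.defect s hs y) :=
  mk_defect_eq X s hs ((exists_bisection (h := h) X).choose_spec _)

end Rho

lemma compat_incl : Compat (M := M) (M' := M) h.incl (LinearMap.id) := fun _ _ => rfl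

variable (M) in
/-- `H²(g, M)₁`: the kernel of the restriction map `H²(g, M) → H²(h, M)`. -/
def H2one : Submodule k (H2 k g M) := LinearMap.ker (H2.map h.incl LinearMap.id (compat_incl h))

variable {h} in
/-- A class in `H²(g, M)₁` is represented by a 2-cocycle whose extension is partially split. -/
lemma H2one.exists_split (c : H2one M h) : ∃ f : twoCocycle k g M, H2.mk k g M f = c ∧
    ∃ s : h →ₗ⁅k⁆ LieAlgebra.ofTwoCocycle f, ∀ z : h, (cocycleExt f).proj (s z) = z := by
  obtain ⟨f, hf⟩ := Submodule.Quotient.mk_surjective _ (c : H2 k g M)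
  refine ⟨f, hf, ?_⟩
  have h1 : H2.map h.incl LinearMap.id (compat_incl h) (H2.mk k g M f) = 0 := by
    have := c.2
    rw [← hf] at this
    exact this
  obtain ⟨γ, hγ⟩ := (Submodule.Quotient.mk_eq_zero _).1 h1
  have h2 : ∀ z w : h, f.1 (z : g) (w : g) = ⁅z, γ w⁆ - ⁅w, γ z⁆ - γ ⁅z, w⁆ := fun z w =>
    (congrArg (fun t : twoCochain k h M => t z w) hγ).symm
  let s : h →ₗ⁅k⁆ LieAlgebra.ofTwoCocycle f :=
    { toFun := fun z => ⟨((z : g), - γ z)⟩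
      map_add' := fun a b => by
        rw [map_add, neg_add]
        rfl
      map_smul' := fun t a => by
        rw [map_smul, ← smul_neg]
        rfl
      map_lie' := fun {a b} => by
        change (⟨(((⁅a, b⁆ : h) : g), - γ ⁅a, b⁆)⟩ : LieAlgebra.ofTwoCocycle f) =
          ⟨(⁅(a : g), (b : g)⁆, f.1 (a : g) (b : g) + ⁅a, - γ b⁆ - ⁅b, - γ a⁆)⟩
        rw [h2, lie_neg, lie_neg]
        have e : - γ ⁅a, b⁆ = ⁅a, γ b⁆ - ⁅b, γ a⁆ - γ ⁅a, b⁆ + -⁅a, γ b⁆ - -⁅b, γ a⁆ := by abel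
        rw [← e]
        rfl }
  exact ⟨s, fun z => rfl⟩

variable {h} in
/-- `ρ : H²(g, M)₁ → H¹(g ⧸ h, H¹(h, M))`, computed with a partial splitting of an extension
representing the class. -/
noncomputable def rho (c : H2one M h) : H1 k (g ⧸ h) (H1 k h M) :=
  H1.mk k (g ⧸ h) (H1 k h M) (rhoBar (cocycleExt (H2one.exists_split c).choose)
    (H2one.exists_split c).choose_spec.2.choose (H2one.exists_split c).choose_spec.2.choose_spec)

/-! ### The map `λ` -/

section Lambda

variable {h} (D : LieDerivation k (g ⧸ h) (H1 k h M))

/-- The Lie algebra `𝔭` of all `(x, d)` in `Der(h, M) ⋊ g` with `D (x + h) = [d]`. -/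
def pAlg : LieSubalgebra k (SemiProd g (LieDerivation k h M)) where
  carrier := {e | D (quotMk h e.fst) = H1.mk k h M e.snd}
  add_mem' {a b} ha hb := by
    change D (quotMk h (a.fst + b.fst)) = H1.mk k h M (a.snd + b.snd)
    rw [map_add, map_add, map_add, ha, hb]
  zero_mem' := by
    change D (quotMk h 0) = H1.mk k h M 0
    simp only [map_zero]
  smul_mem' t a ha := by
    change D (quotMk h (t • a.fst)) = H1.mk k h M (t • a.snd)
    rw [map_smul, map_smul, map_smul, ha]
  lie_mem' {a b} ha hb := by
    obtain ⟨x, d⟩ := a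
    obtain ⟨y, d'⟩ := b
    replace ha : D (quotMk h x) = H1.mk k h M d := ha
    replace hb : D (quotMk h y) = H1.mk k h M d' := hb
    rw [SemiProd.lie_mk]
    change D (quotMk h ⁅x, y⁆) = H1.mk k h M (⁅x, d'⁆ - ⁅y, d⁆)
    rw [LieHom.map_lie, LieDerivation.apply_lie_eq_sub, ha, hb, map_sub]
    rfl

/-- The action `(x, d) · (z, m) = ([x, z], x · m + d z)` for fixed `(x, d)`, as a linear map. -/
def semiActAux (x : g) (d : LieDerivation k h M) : SemiProd h M →ₗ[k] SemiProd h M where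
  toFun v := ⟨⁅x, v.fst⁆, ⁅x, v.snd⁆ + d v.fst⟩
  map_add' := by
    rintro ⟨z, m⟩ ⟨w, n⟩
    simp only [SemiProd.add_mk, lie_add, map_add]
    rw [add_add_add_comm]
  map_smul' := by
    rintro t ⟨z, m⟩
    simp only [SemiProd.smul_mk, lie_smul, map_smul, smul_add, RingHom.id_apply]

lemma semiActAux_apply (x : g) (d : LieDerivation k h M) (z : h) (m : M) :
    semiActAux x d ⟨z, m⟩ = ⟨⁅x, z⁆, ⁅x, m⁆ + d z⟩ := rfl

/-- The action `(x, d) · (z, m) = ([x, z], x · m + d z)` for fixed `(x, d)`, as a derivation of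
`M ⋊ h`. -/
def semiActDer (x : g) (d : LieDerivation k h M) :
    LieDerivation k (SemiProd h M) (SemiProd h M) where
  toLinearMap := semiActAux x d
  leibniz' := by
    rintro ⟨z, m⟩ ⟨w, n⟩
    have e0 : ∀ (z : h) (m : M), ⁅z, m⁆ = ⁅(z : g), m⁆ := fun _ _ => rfl
    have e1 : ⁅x, ⁅z, w⁆⁆ = ⁅z, ⁅x, w⁆⁆ - ⁅w, ⁅x, z⁆⁆ := by
      apply Subtype.ext
      change ⁅x, ⁅(z : g), (w : g)⁆⁆ = ⁅(z : g), ⁅x, (w : g)⁆⁆ - ⁅(w : g), ⁅x, (z : g)⁆⁆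
      rw [leibniz_lie x, ← lie_skew ⁅x, (z : g)⁆]
      abel
    have e2 : ⁅x, ⁅z, n⁆ - ⁅w, m⁆⁆ + d ⁅z, w⁆ =
        (⁅z, ⁅x, n⁆ + d w⁆ - ⁅⁅x, w⁆, m⁆) - (⁅w, ⁅x, m⁆ + d z⁆ - ⁅⁅x, z⁆, n⁆) := by
      simp only [LieDerivation.apply_lie_eq_sub, e0, LieSubmodule.coe_bracket, lie_lie,
        lie_add, lie_sub]
      abel
    rw [SemiProd.lie_mk, semiActAux_apply, semiActAux_apply, semiActAux_apply, SemiProd.lie_mk,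
      SemiProd.lie_mk, SemiProd.sub_mk, e1, e2]

lemma semiActDer_apply (x : g) (d : LieDerivation k h M) (z : h) (m : M) :
    semiActDer x d ⟨z, m⟩ = ⟨⁅x, z⁆, ⁅x, m⁆ + d z⟩ := rfl

lemma semiActDer_add (x y : g) (d d' : LieDerivation k h M) :
    semiActDer (x + y) (d + d') = semiActDer x d + semiActDer y d' := by
  apply LieDerivation.ext
  rintro ⟨z, m⟩
  rw [LieDerivation.add_apply, semiActDer_apply, semiActDer_apply, semiActDer_apply,
    SemiProd.add_mk, add_lie, add_lie, LieDerivation.add_apply, add_add_add_comm]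

lemma semiActDer_smul (t : k) (x : g) (d : LieDerivation k h M) :
    semiActDer (t • x) (t • d) = t • semiActDer x d := by
  apply LieDerivation.ext
  rintro ⟨z, m⟩
  rw [LieDerivation.smul_apply, semiActDer_apply, semiActDer_apply,
    SemiProd.smul_mk, smul_lie, smul_lie, LieDerivation.smul_apply, smul_add]

lemma semiActDer_lie (x y : g) (d d' : LieDerivation k h M) :
    semiActDer ⁅x, y⁆ (⁅x, d'⁆ - ⁅y, d⁆) = ⁅semiActDer x d, semiActDer y d'⁆ := by
  apply LieDerivation.ext
  rintro ⟨z, m⟩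
  have e2 : ⁅⁅x, y⁆, m⁆ + (⁅x, d'⁆ - ⁅y, d⁆) z =
      (⁅x, ⁅y, m⁆ + d' z⁆ + d ⁅y, z⁆) - (⁅y, ⁅x, m⁆ + d z⁆ + d' ⁅x, z⁆) := by
    rw [LieDerivation.sub_apply, lie_der_apply, lie_der_apply]
    simp only [lie_lie, lie_add]
    abel
  rw [LieDerivation.lie_apply, semiActDer_apply, semiActDer_apply, semiActDer_apply,
    semiActDer_apply, semiActDer_apply, SemiProd.sub_mk, e2, lie_lie]

/-- The action `(x, d) · (z, m) = ([x, z], x · m + d z)` of `Der(h, M) ⋊ g` on `M ⋊ h`. -/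
def semiAct : SemiProd g (LieDerivation k h M) →ₗ⁅k⁆
    LieDerivation k (SemiProd h M) (SemiProd h M) where
  toFun e := semiActDer e.fst e.snd
  map_add' u v := semiActDer_add u.fst v.fst u.snd v.snd
  map_smul' t u := semiActDer_smul t u.fst u.snd
  map_lie' {u v} := by
    obtain ⟨x, d⟩ := u
    obtain ⟨y, d'⟩ := v
    rw [SemiProd.lie_mk]
    exact semiActDer_lie x y d d'

/-- The map `(z, m) ↦ (z, - δ m)` from `M ⋊ h` to `Der(h, M) ⋊ g`, where `δ m` is the inner
derivation `w ↦ w · m`. -/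
def semiBd : SemiProd h M →ₗ⁅k⁆ SemiProd g (LieDerivation k h M) where
  toFun v := ⟨(v.fst : g), - LieDerivation.inner k h M v.snd⟩
  map_add' := by
    rintro ⟨z, m⟩ ⟨w, n⟩
    simp only [SemiProd.add_mk, map_add, neg_add]
    rfl
  map_smul' := by
    rintro t ⟨z, m⟩
    simp only [SemiProd.smul_mk, map_smul, smul_neg, RingHom.id_apply]
    rfl
  map_lie' := by
    rintro ⟨z, m⟩ ⟨w, n⟩
    have e : - LieDerivation.inner k h M (⁅z, n⁆ - ⁅w, m⁆) =
        ⁅(z : g), - LieDerivation.inner k h M n⁆ - ⁅(w : g), - LieDerivation.inner k h M m⁆ := by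
      have e0 : ∀ (z : h) (m : M), ⁅z, m⁆ = ⁅(z : g), m⁆ := fun _ _ => rfl
      rw [lie_neg, lie_neg, lie_inner, lie_inner, map_sub, e0, e0]
      abel
    rw [SemiProd.lie_mk, SemiProd.lie_mk, e]
    rfl

lemma semiBd_apply (z : h) (m : M) :
    semiBd (⟨z, m⟩ : SemiProd h M) = ⟨(z : g), - LieDerivation.inner k h M m⟩ := rfl

lemma semiBd_mem (v : SemiProd h M) : semiBd v ∈ pAlg D := by
  change D (quotMk h (v.fst : g)) = H1.mk k h M (- LieDerivation.inner k h M v.snd)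
  have h1 : quotMk h (v.fst : g) = 0 := quotMk_eq_zero.2 v.fst.2
  have h2 : H1.mk k h M (LieDerivation.inner k h M v.snd) = 0 :=
    H1.mk_eq_zero.2 ⟨_, rfl⟩
  rw [h1, map_zero, map_neg, h2, neg_zero]

lemma semiBd_act (x : g) (d : LieDerivation k h M) (v : SemiProd h M) :
    semiBd (semiActDer x d v) =
      ⁅(⟨x, d⟩ : SemiProd g (LieDerivation k h M)), semiBd v⁆ := by
  obtain ⟨z, m⟩ := v
  rw [semiActDer_apply, semiBd_apply, semiBd_apply, SemiProd.lie_mk, lie_neg, lie_inner,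
    mem_lie_der h z z.2, map_add, neg_add, sub_eq_add_neg]
  rfl

lemma semiAct_bd (v w : SemiProd h M) :
    semiActDer (v.fst : g) (- LieDerivation.inner k h M v.snd) w = ⁅v, w⁆ := by
  obtain ⟨z, m⟩ := v
  obtain ⟨w, n⟩ := w
  rw [SemiProd.lie_mk, semiActDer_apply, sub_eq_add_neg]
  rfl

lemma semiBd_eq_zero (z : h) (m : M) :
    semiBd (⟨z, m⟩ : SemiProd h M) = 0 ↔ z = 0 ∧ LieDerivation.inner k h M m = 0 := by
  rw [semiBd_apply]
  constructor
  · intro h0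
    have h1 : (z : g) = 0 := congrArg (fun e => e.fst) h0
    have h2 : - LieDerivation.inner k h M m = 0 := congrArg (fun e => e.snd) h0
    exact ⟨Subtype.ext h1, neg_eq_zero.1 h2⟩
  · rintro ⟨rfl, h2⟩
    rw [h2, neg_zero]
    rfl

lemma inner_eq_zero (m : M) : LieDerivation.inner k h M m = 0 ↔ m ∈ Inv M h :=
  ⟨fun H w => LieDerivation.congr_fun H w, fun H => LieDerivation.ext fun w => H w⟩

lemma semiBd_exact (v : SemiProd h M) :
    semiBd v = 0 ↔ ∃ m : Inv M h, (⟨0, (m : M)⟩ : SemiProd h M) = v := by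
  obtain ⟨z, m⟩ := v
  rw [semiBd_eq_zero, inner_eq_zero]
  constructor
  · rintro ⟨rfl, hm⟩
    exact ⟨⟨m, hm⟩, rfl⟩
  · rintro ⟨v, hv⟩
    have h1 : (0 : h) = z := congrArg (fun e => e.fst) hv
    have h2 : (v : M) = m := congrArg (fun e => e.snd) hv
    rw [← h1, ← h2]
    exact ⟨rfl, v.2⟩

lemma semiBd_range (x : g) (d : LieDerivation k h M) (hx : x ∈ h) (hd : H1.mk k h M d = 0) :
    ∃ v : SemiProd h M, semiBd v = ⟨x, d⟩ := by
  obtain ⟨m, hm⟩ := H1.mk_eq_zero.1 hd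
  refine ⟨⟨⟨x, hx⟩, - m⟩, ?_⟩
  rw [semiBd_apply, map_neg, neg_neg, hm]

/-- The crossed extension `0 → M^h → M ⋊ h → 𝔭 → g ⧸ h → 0` attached to `D`, with boundary map
`(z, m) ↦ (z, - δ m)` where `δ m` is the inner derivation `w ↦ w · m`. -/
def crossedOf : CrossedExt k (g ⧸ h) (Inv M h) (SemiProd h M) (pAlg D) where
  incl :=
    { toFun := fun m => ⟨0, (m : M)⟩
      map_add' := fun a b => by
        change (⟨0, (a : M) + b⟩ : SemiProd h M) = ⟨0 + 0, (a : M) + b⟩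
        rw [add_zero]
      map_smul' := fun t a => by
        change (⟨0, t • (a : M)⟩ : SemiProd h M) = ⟨t • 0, t • (a : M)⟩
        rw [smul_zero] }
  bd :=
    { toFun := fun v => ⟨semiBd v, semiBd_mem D v⟩
      map_add' := fun v w => Subtype.ext (map_add semiBd v w)
      map_smul' := fun t v => Subtype.ext (map_smul semiBd t v)
      map_lie' := fun {v w} => Subtype.ext (LieHom.map_lie semiBd v w) }
  act := semiAct.comp (pAlg D).incl
  proj :=
    { toFun := fun e => quotMk h e.1.fst
      map_add' := fun _ _ => rfl
      map_smul' := fun _ _ => rfl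
      map_lie' := rfl }
  bd_act n v := Subtype.ext (semiBd_act n.1.fst n.1.snd v)
  act_bd v w := semiAct_bd v w
  incl_injective a b hab := Subtype.ext (congrArg (fun e => e.snd) hab)
  exact_left v := ⟨fun hv => (semiBd_exact v).1 (congrArg Subtype.val hv),
    fun hv => Subtype.ext ((semiBd_exact v).2 hv)⟩
  exact_right n := by
    constructor
    · intro hx
      have h1 : H1.mk k h M n.1.snd = 0 :=
        (n.2 : D (quotMk h n.1.fst) = _).symm.trans ((congrArg D hx).trans (map_zero D))
      obtain ⟨v, hv⟩ := semiBd_range n.1.fst n.1.snd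
        (quotMk_eq_zero.1 hx) h1
      exact ⟨v, Subtype.ext hv⟩
    · rintro ⟨v, rfl⟩
      exact quotMk_eq_zero.2 v.fst.2
  proj_surjective := by
    intro y
    obtain ⟨x, rfl⟩ := Submodule.Quotient.mk_surjective _ y
    obtain ⟨d, hd⟩ := H1.exists_rep (D (quotMk h x))
    exact ⟨⟨⟨x, d⟩, hd.symm⟩, rfl⟩
  act_incl := by
    rintro ⟨⟨x, d⟩, he⟩ v
    change (⟨⁅x, (0 : h)⁆, ⁅x, (v : M)⁆ + d 0⟩ : SemiProd h M) = ⟨0, ⁅x, (v : M)⁆⟩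
    rw [lie_zero, map_zero, add_zero]


end Lambda

variable {h}

/-- The class in `H³(g ⧸ h, M^h)` attached to a derivation `D : g ⧸ h → H¹(h, M)`. -/
noncomputable def lamHat (D : LieDerivation k (g ⧸ h) (H1 k h M)) : H3 k (g ⧸ h) (Inv M h) :=
  (crossedOf D).cls

/-- `λ : H¹(g ⧸ h, H¹(h, M)) → H³(g ⧸ h, M^h)`, computed with a derivation representing the
class. -/
noncomputable def lam (c : H1 k (g ⧸ h) (H1 k h M)) : H3 k (g ⧸ h) (Inv M h) :=
  lamHat (H1.exists_rep c).choose

/-! ### Inflation and restriction -/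

variable (M h)

lemma compat_infl : Compat (M := Inv M h) (M' := M) (quotMk h) (Inv M h).toSubmodule.subtype :=
  fun _ _ => rfl

/-- The inflation map `H¹(g ⧸ h, M^h) → H¹(g, M)`. -/
def infl₁ : H1 k (g ⧸ h) (Inv M h) →ₗ[k] H1 k g M := H1.map _ _ (compat_infl M h)

/-- The restriction map `H¹(g, M) → H¹(h, M)^(g ⧸ h)`. -/
def res₁ : H1 k g M →ₗ[k] InvH1 M h :=
  (H1.map h.incl LinearMap.id (compat_incl h)).codRestrict (InvH1 M h).toSubmodule (by
    intro c x
    obtain ⟨d, rfl⟩ := H1.exists_rep c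
    obtain ⟨x, rfl⟩ := Submodule.Quotient.mk_surjective _ x
    refine H1.mk_eq_zero.2 ⟨d x, ?_⟩
    ext z
    change ⁅(z : g), d x⁆ = ⁅x, d z⁆ - d ⁅x, (z : g)⁆
    rw [LieDerivation.apply_lie_eq_sub, sub_sub_cancel])

/-- The inflation map `H²(g ⧸ h, M^h) → H²(g, M)₁`. -/
def infl₂ : H2 k (g ⧸ h) (Inv M h) →ₗ[k] H2one M h :=
  (H2.map _ _ (compat_infl M h)).codRestrict (H2one M h) (by
    intro c
    obtain ⟨f, rfl⟩ := Submodule.Quotient.mk_surjective _ c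
    refine (Submodule.Quotient.mk_eq_zero _).2 ⟨0, ?_⟩
    rw [map_zero]
    ext z w
    have h1 : quotMk h (z : g) = 0 := quotMk_eq_zero.2 z.2
    change (0 : M) = ((f.1 (quotMk h (z : g)) (quotMk h (w : g)) : Inv M h) : M)
    rw [h1, map_zero]
    rfl)

end Ideal

/-! ### Morphisms of extensions -/

section Morphism

variable {k g g' M : Type*} [Field k] [LieRing g] [LieAlgebra k g] [LieRing g'] [LieAlgebra k g']
  [AddCommGroup M] [Module k M] [LieRingModule g M] [LieModule k g M]
  [LieRingModule g' M] [LieModule k g' M]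
  {h : LieIdeal k g} {h' : LieIdeal k g'} (α : g' →ₗ⁅k⁆ g) (hα : ∀ z ∈ h', α z ∈ h)

/-- The map `h' → h` induced by `α`. -/
def idealMap : h' →ₗ⁅k⁆ h where
  toFun z := ⟨α z, hα z z.2⟩
  map_add' _ _ := Subtype.ext (map_add α _ _)
  map_smul' _ _ := Subtype.ext (map_smul α _ _)
  map_lie' := Subtype.ext (LieHom.map_lie α _ _)

/-- The map `g' ⧸ h' → g ⧸ h` induced by `α`. -/
def quotMap : (g' ⧸ h') →ₗ⁅k⁆ g ⧸ h :=
  { Submodule.mapQ h'.toSubmodule h.toSubmodule (α : g' →ₗ[k] g) hα with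
    map_lie' := by
      intro x y
      obtain ⟨x, rfl⟩ := Submodule.Quotient.mk_surjective _ x
      obtain ⟨y, rfl⟩ := Submodule.Quotient.mk_surjective _ y
      exact congrArg (quotMk h) (LieHom.map_lie α x y) }

variable (hM : ∀ (x : g') (m : M), ⁅x, m⁆ = ⁅α x, m⁆)

lemma compat_id (hM : ∀ (x : g') (m : M), ⁅x, m⁆ = ⁅α x, m⁆) :
    Compat (M := M) (M' := M) α LinearMap.id := fun x m => (hM x m).symm

lemma compat_idealMap (hM : ∀ (x : g') (m : M), ⁅x, m⁆ = ⁅α x, m⁆) :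
    Compat (M := M) (M' := M) (idealMap α hα) LinearMap.id :=
  fun x m => (hM x m).symm

/-- The inclusion `M^h → M^h'`. -/
def invIncl : Inv M h →ₗ[k] Inv M h' where
  toFun m := ⟨m, fun z => (hM z m).trans (m.2 ⟨α z, hα z z.2⟩)⟩
  map_add' _ _ := rfl
  map_smul' _ _ := rfl

lemma compat_invIncl : Compat (quotMap α hα) (invIncl (M := M) α hα hM) := by
  intro x m
  obtain ⟨x, rfl⟩ := Submodule.Quotient.mk_surjective _ x
  exact Subtype.ext (hM x m).symm

/-- `α* : H¹(h, M) → H¹(h', M)`. -/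
def pullH1Ideal : H1 k h M →ₗ[k] H1 k h' M :=
  H1.map (idealMap α hα) LinearMap.id (compat_idealMap α hα hM)

lemma compat_pullH1Ideal : Compat (quotMap α hα) (pullH1Ideal (M := M) α hα hM) := by
  intro x c
  obtain ⟨x, rfl⟩ := Submodule.Quotient.mk_surjective _ x
  obtain ⟨d, rfl⟩ := H1.exists_rep c
  refine congrArg (H1.mk k h' M) ?_
  ext z
  change ⁅α x, d (idealMap α hα z)⁆ - d ⁅α x, idealMap α hα z⁆ =
    ⁅x, d (idealMap α hα z)⁆ - d (idealMap α hα ⁅x, z⁆)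
  rw [hM]
  congr 2
  exact Subtype.ext (LieHom.map_lie α x z).symm

/-- `α* : H¹(g ⧸ h, M^h) → H¹(g' ⧸ h', M^h')`. -/
def pullH1Quot : H1 k (g ⧸ h) (Inv M h) →ₗ[k] H1 k (g' ⧸ h') (Inv M h') :=
  H1.map _ _ (compat_invIncl α hα hM)

/-- `α* : H¹(g, M) → H¹(g', M)`. -/
def pullH1 : H1 k g M →ₗ[k] H1 k g' M := H1.map _ _ (compat_id α hM)

/-- `α* : H¹(h, M)^(g ⧸ h) → H¹(h', M)^(g' ⧸ h')`. -/
def pullInvH1 : InvH1 M h →ₗ[k] InvH1 M h' :=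
  (pullH1Ideal α hα hM).restrict (p := (InvH1 M h).toSubmodule) (q := (InvH1 M h').toSubmodule) (by
    intro c hc x
    rw [← compat_pullH1Ideal α hα hM, hc (quotMap α hα x), map_zero])

/-- `α* : H²(g ⧸ h, M^h) → H²(g' ⧸ h', M^h')`. -/
def pullH2Quot : H2 k (g ⧸ h) (Inv M h) →ₗ[k] H2 k (g' ⧸ h') (Inv M h') :=
  H2.map _ _ (compat_invIncl α hα hM)

/-- `α* : H²(g, M)₁ → H²(g', M)₁`. -/
def pullH2one : H2one M h →ₗ[k] H2one M h' :=
  (H2.map _ _ (compat_id α hM)).restrict (by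
    intro c hc
    obtain ⟨f, rfl⟩ := Submodule.Quotient.mk_surjective _ c
    exact (congrArg (H2.map (idealMap α hα) LinearMap.id (compat_idealMap α hα hM)) hc).trans
      (map_zero _))

/-- `α* : H¹(g ⧸ h, H¹(h, M)) → H¹(g' ⧸ h', H¹(h', M))`. -/
def pullH1H1 : H1 k (g ⧸ h) (H1 k h M) →ₗ[k] H1 k (g' ⧸ h') (H1 k h' M) :=
  H1.map _ _ (compat_pullH1Ideal α hα hM)

/-- `α* : H³(g ⧸ h, M^h) → H³(g' ⧸ h', M^h')`. -/
def pullH3Quot : H3 k (g ⧸ h) (Inv M h) →ₗ[k] H3 k (g' ⧸ h') (Inv M h') :=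
  H3.map _ _ (compat_invIncl α hα hM)

end Morphism

end LieExt

/-!
The squares for inflation and restriction commute on representatives. For `tr`, `ρ` and `λ` the
difficulty is that the classes are defined by choices of representatives, sections and splittings,
and that for `tr` and `λ` the map `α` induces no homomorphism in either direction between the
extensions to be compared.

The first step is that the pullback along `φ : L' → L` of the class of an extension of `L` (or of a
crossed extension) can be computed from any linear lift `L' → E` of `φ`, not only from a lift of the
form section after `φ` (`ModExt.map_cls_eq_mk`, `CrossedExt.map_cls_eq_mk`): changing the lift
changes the cocycle by an explicit coboundary. For `φ` the identity this is independence of the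
choice of section. It then suffices to find linear data for `(g', h')` and a linear lift for
`(g, h)` which give the same cocycle.

* For `tr` (`map_trHat`) these come from a span: the subalgebra of `M ⋊ g'` of the elements whose
  image in `M ⋊ g` idealizes the graph of `d` maps to both idealizers.
* For `ρ` (`map_mk_rhoBar`) a 2-cocycle cohomologous to the pullback of `f` gives a homomorphism
  between the two extensions over `α`. It respects the partial splittings up to a derivation
  `e : h' → M`, and the resulting derivations into `H¹(h', M)` differ by the inner derivation
  of `[e]`.
* For `λ` (`map_lamHat`) a linear section of `g' → g' ⧸ h'` and a linear choice of representatives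
  of classes in `H¹(h, M)` determine a section into the algebra `𝔭` of `(g', h')` and a lift into
  that of `(g, h)`. The curvatures of both lift along one cochain with values in `M ⋊ h'`, so the
  formal coboundaries agree.

In each case the representatives are related only up to inner derivations, so that the same lemma
also absorbs the choice of representative made in the definition of the map.
-/

namespace LieExt

/-! ### Comparison of extension classes -/

section ModExt

variable {k L L' M M' E E' P : Type*} [Field k] [LieRing L] [LieAlgebra k L]
  [LieRing L'] [LieAlgebra k L']
  [AddCommGroup M] [Module k M] [LieRingModule L M] [LieModule k L M]
  [AddCommGroup M'] [Module k M'] [LieRingModule L' M'] [LieModule k L' M']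
  [LieRing E] [LieAlgebra k E] [LieRing E'] [LieAlgebra k E'] [LieRing P] [LieAlgebra k P]

/-- The pullback of the class of an extension along `φ` can be computed from the curvature of any
linear lift `τ` of `φ`, which need not factor through a section of the extension. -/
lemma ModExt.map_cls_eq_mk (X : ModExt k L M E) (φ : L' →ₗ⁅k⁆ L) (ψ : M →ₗ[k] M')
    (H : Compat φ ψ) (τ : L' →ₗ[k] E) (hτ : ∀ x, X.proj (τ x) = φ x)
    (f : twoCocycle k L' M') (hf : ∀ x y, f.1 x y = ψ (X.toM (⁅τ x, τ y⁆ - τ ⁅x, y⁆))) :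
    H2.map φ ψ H X.cls = H2.mk k L' M' f := by
  have hs := X.exists_section.choose_spec
  unfold ModExt.cls
  set s := X.exists_section.choose
  let γ : L' →ₗ[k] M := X.toM ∘ₗ (s ∘ₗ (φ : L' →ₗ[k] L) - τ)
  have hγ : ∀ x, s (φ x) = τ x + X.incl (γ x) := fun x => by
    have h1 : X.incl (γ x) = s (φ x) - τ x := X.incl_toM (by
      change X.proj (s (φ x) - τ x) = 0
      rw [map_sub, hs, hτ, sub_self])
    rw [h1, add_sub_cancel]
  refine (Submodule.Quotient.eq _).2 ⟨ψ ∘ₗ γ, ?_⟩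
  ext x y
  change ⁅x, ψ (γ y)⁆ - ⁅y, ψ (γ x)⁆ - ψ (γ ⁅x, y⁆) =
    ψ (X.toM (⁅s (φ x), s (φ y)⁆ - s ⁅φ x, φ y⁆)) - f.1 x y
  rw [hf, ← H, ← H, ← map_sub, ← map_sub, ← map_sub, ← map_sub]
  congr 1
  rw [← X.toM_incl (⁅φ x, γ y⁆ - ⁅φ y, γ x⁆ - γ ⁅x, y⁆)]
  congr 1
  have h0 : ⁅X.incl (γ x), X.incl (γ y)⁆ = 0 := by
    rw [X.lie_incl, X.proj_incl, zero_lie, map_zero]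
  have h1 : ⁅X.incl (γ x), τ y⁆ = - X.incl ⁅φ y, γ x⁆ := by
    rw [← lie_skew, X.lie_incl, hτ]
  rw [← LieHom.map_lie, hγ, hγ, hγ, add_lie, lie_add, lie_add, h0, h1, X.lie_incl, hτ, map_sub,
    map_sub]
  abel

lemma H2.map_id (H : Compat (LieHom.id : L →ₗ⁅k⁆ L) (LinearMap.id : M →ₗ[k] M))
    (c : H2 k L M) : H2.map LieHom.id LinearMap.id H c = c := by
  obtain ⟨f, rfl⟩ := Submodule.Quotient.mk_surjective _ c
  rfl

lemma H3.map_id (H : Compat (LieHom.id : L →ₗ⁅k⁆ L) (LinearMap.id : M →ₗ[k] M))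
    (c : H3 k L M) : H3.map LieHom.id LinearMap.id H c = c := by
  obtain ⟨f, rfl⟩ := Submodule.Quotient.mk_surjective _ c
  rfl

/-- The class of an extension does not depend on the linear section. -/
lemma ModExt.cls_eq_mk (X : ModExt k L M E) (s : L →ₗ[k] E) (hs : ∀ x, X.proj (s x) = x) :
    X.cls = H2.mk k L M (X.cocycleOf s hs) := by
  have H : Compat (LieHom.id : L →ₗ⁅k⁆ L) (LinearMap.id : M →ₗ[k] M) := fun _ _ => rfl
  rw [← X.map_cls_eq_mk LieHom.id LinearMap.id H s hs (X.cocycleOf s hs) (fun _ _ => rfl),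
    H2.map_id]

/-- Naturality of the class of an extension along a span `E ← P → E'` of Lie algebras: a linear
section of `E' → L'` which lifts to `P` gives a linear lift of `φ` to `E` with corresponding
curvature. -/
lemma ModExt.map_cls_of_span (X : ModExt k L M E) (X' : ModExt k L' M' E')
    (φ : L' →ₗ⁅k⁆ L) (ψ : M →ₗ[k] M') (H : Compat φ ψ) (a : P →ₗ⁅k⁆ E) (b : P →ₗ⁅k⁆ E')
    (hab : ∀ p, X.proj (a p) = φ (X'.proj (b p)))
    (hb : ∀ x, ∃ p, X'.proj (b p) = x)
    (hker : ∀ p m, a p = X.incl m → X'.proj (b p) = 0 → b p = X'.incl (ψ m)) :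
    H2.map φ ψ H X.cls = X'.cls := by
  obtain ⟨u, hu⟩ := LinearMap.exists_rightInverse_of_surjective
    ((X'.proj.comp b : P →ₗ⁅k⁆ L') : P →ₗ[k] L') (LinearMap.range_eq_top.2 hb)
  replace hu : ∀ x, X'.proj (b (u x)) = x := fun x => LinearMap.congr_fun hu x
  rw [X'.cls_eq_mk ((b : P →ₗ[k] E') ∘ₗ u) hu]
  refine X.map_cls_eq_mk φ ψ H ((a : P →ₗ[k] E) ∘ₗ u) (fun x => ?_) _ fun x y => ?_
  · exact (hab _).trans (congrArg φ (hu x))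
  · change X'.toM (⁅b (u x), b (u y)⁆ - b (u ⁅x, y⁆)) =
      ψ (X.toM (⁅a (u x), a (u y)⁆ - a (u ⁅x, y⁆)))
    simp only [← LieHom.map_lie, ← map_sub]
    have h1 : X'.proj (b (⁅u x, u y⁆ - u ⁅x, y⁆)) = 0 := by
      simp [hu]
    obtain ⟨m, hm⟩ := (X.exact (a (⁅u x, u y⁆ - u ⁅x, y⁆))).1 (by rw [hab, h1, map_zero])
    rw [hker _ m hm.symm h1, ← hm, X.toM_incl, X'.toM_incl]

end ModExt

/-! ### Comparison of classes of crossed extensions -/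

namespace CrossedExt

variable {k L L' M M' 𝔪 𝔫 : Type*} [Field k] [LieRing L] [LieAlgebra k L]
  [LieRing L'] [LieAlgebra k L']
  [AddCommGroup M] [Module k M] [LieRingModule L M] [LieModule k L M]
  [AddCommGroup M'] [Module k M'] [LieRingModule L' M'] [LieModule k L' M']
  [LieRing 𝔪] [LieAlgebra k 𝔪] [LieRing 𝔫] [LieAlgebra k 𝔫]

/-- The formal coboundary of an `𝔪`-valued 2-cochain `F` on a Lie algebra `L'` which acts on `𝔪`
through a linear map `τ : L' → 𝔫`. -/
def formalAlong (X : CrossedExt k L M 𝔪 𝔫) (τ : L' →ₗ[k] 𝔫) (F : twoCochain k L' 𝔪)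
    (x y z : L') : 𝔪 :=
  X.act (τ x) (F y z) - X.act (τ y) (F x z) + X.act (τ z) (F x y)
    - F ⁅x, y⁆ z + F ⁅x, z⁆ y - F ⁅y, z⁆ x

lemma bd_formalAlong (X : CrossedExt k L M 𝔪 𝔫) (τ : L' →ₗ[k] 𝔫)
    (F : twoCochain k L' 𝔪) (hF : ∀ x y, X.bd (F x y) = ⁅τ x, τ y⁆ - τ ⁅x, y⁆) (x y z : L') :
    X.bd (X.formalAlong τ F x y z) = 0 := by
  simp only [formalAlong, map_sub, map_add, X.bd_act, hF, lie_sub]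
  have j1 : ⁅τ x, ⁅τ y, τ z⁆⁆ = ⁅⁅τ x, τ y⁆, τ z⁆ + ⁅τ y, ⁅τ x, τ z⁆⁆ := leibniz_lie _ _ _
  have j2 : τ ⁅x, ⁅y, z⁆⁆ = τ ⁅⁅x, y⁆, z⁆ + τ ⁅y, ⁅x, z⁆⁆ := by rw [leibniz_lie x, map_add]
  have k2 : τ ⁅⁅x, z⁆, y⁆ = - τ ⁅y, ⁅x, z⁆⁆ := by rw [← lie_skew, map_neg]
  have k3 : τ ⁅⁅y, z⁆, x⁆ = - τ ⁅x, ⁅y, z⁆⁆ := by rw [← lie_skew, map_neg]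
  rw [k2, k3, j1, j2, ← lie_skew (τ z) ⁅τ x, τ y⁆, ← lie_skew (τ ⁅x, y⁆) (τ z),
    ← lie_skew (τ ⁅x, z⁆) (τ y), ← lie_skew (τ ⁅y, z⁆) (τ x)]
  abel

/-- Two linear lifts `σ`, `τ` of the same map `L' → L`, with lifts `F`, `G` of their curvatures,
have formal coboundaries which differ by the coboundary of an `M`-valued 2-cochain. -/
lemma exists_formalAlong_eq_add (X : CrossedExt k L M 𝔪 𝔫) (σ τ : L' →ₗ[k] 𝔫)
    (F G : twoCochain k L' 𝔪) (hst : ∀ x, X.proj (τ x) = X.proj (σ x))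
    (hF : ∀ x y, X.bd (F x y) = ⁅σ x, σ y⁆ - σ ⁅x, y⁆)
    (hG : ∀ x y, X.bd (G x y) = ⁅τ x, τ y⁆ - τ ⁅x, y⁆) :
    ∃ ω : twoCochain k L' M, ∀ x y z, X.formalAlong τ G x y z = X.formalAlong σ F x y z +
      X.incl (⁅X.proj (σ x), ω y z⁆ - ⁅X.proj (σ y), ω x z⁆ + ⁅X.proj (σ z), ω x y⁆
        - ω ⁅x, y⁆ z + ω ⁅x, z⁆ y - ω ⁅y, z⁆ x) := by
  -- `τ = σ + bd ∘ β` for a linear map `β : L' → 𝔪`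
  obtain ⟨t, ht⟩ := LinearMap.exists_rightInverse_of_surjective
    (X.bd : 𝔪 →ₗ[k] 𝔫).rangeRestrict (LinearMap.range_rangeRestrict _)
  let β : L' →ₗ[k] 𝔪 := t ∘ₗ (τ - σ).codRestrict (LinearMap.range (X.bd : 𝔪 →ₗ[k] 𝔫))
    (fun x => (X.exact_right _).1 (by simp [hst]))
  have hβ : ∀ x, τ x = σ x + X.bd (β x) := fun x => by
    have h1 : X.bd (β x) = τ x - σ x :=
      congrArg Subtype.val (LinearMap.congr_fun ht (⟨(τ - σ) x, _⟩ :
        LinearMap.range (X.bd : 𝔪 →ₗ[k] 𝔫)))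
    rw [h1, add_sub_cancel]
  -- the lift of the curvature of `τ` which `F` and `β` determine differs from `G` by a cochain `ω`
  have hbd : ∀ x y, X.bd (G x y - (F x y + X.act (σ x) (β y) - X.act (σ y) (β x) + ⁅β x, β y⁆
      - β ⁅x, y⁆)) = 0 := fun x y => by
    have l1 : ⁅X.bd (β x), σ y⁆ = - ⁅σ y, X.bd (β x)⁆ := (lie_skew _ _).symm
    simp only [map_sub, map_add, hF, hG, X.bd_act, LieHom.map_lie, hβ, lie_add, add_lie, l1]
    abel
  let ω : twoCochain k L' M := ⟨LinearMap.mk₂ k (fun x y => X.toM (G x y -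
        (F x y + X.act (σ x) (β y) - X.act (σ y) (β x) + ⁅β x, β y⁆ - β ⁅x, y⁆)))
      (fun _ _ _ => by
        rw [← map_add]; congr 1
        simp only [map_add, add_lie, LinearMap.add_apply, LieDerivation.add_apply]; abel)
      (fun _ _ _ => by
        rw [← map_smul]; congr 1
        simp only [map_smul, smul_lie, LinearMap.smul_apply, LieDerivation.smul_apply, smul_add,
          smul_sub])
      (fun _ _ _ => by
        rw [← map_add]; congr 1
        simp only [map_add, lie_add, LieDerivation.add_apply]; abel)
      (fun _ _ _ => by
        rw [← map_smul]; congr 1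
        simp only [map_smul, lie_smul, LieDerivation.smul_apply, smul_add, smul_sub]),
    fun x => by simp⟩
  have hω : ∀ x y, G x y = F x y + X.act (σ x) (β y) - X.act (σ y) (β x) + ⁅β x, β y⁆ - β ⁅x, y⁆
      + X.incl (ω x y) := fun x y => by
    have h1 : X.incl (ω x y) = _ := X.incl_toM (hbd x y)
    rw [h1, add_sub_cancel]
  refine ⟨ω, fun x y z => ?_⟩
  -- after substitution, the terms in `F` and `β` cancel because `σ` acts up to its curvature
  -- (`comm`), `𝔫` acts by derivations (`der`) and `L'` and `𝔪` satisfy the Jacobi identity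
  have act : ∀ (a : L') (m : M), X.act (σ a) (X.incl m) = X.incl ⁅X.proj (σ a), m⁆ :=
    fun a m => X.act_incl _ _
  have lie0 : ∀ (a : 𝔪) (m : M), ⁅a, X.incl m⁆ = 0 := fun a m => by
    rw [← X.act_bd, X.act_incl, (X.exact_right _).2 ⟨a, rfl⟩, zero_lie, map_zero]
  have comm : ∀ (a b : L') (m : 𝔪), X.act (σ a) (X.act (σ b) m) =
      X.act (σ b) (X.act (σ a) m) + ⁅F a b, m⁆ + X.act (σ ⁅a, b⁆) m := fun a b m => by
    have h1 : X.act ⁅σ a, σ b⁆ m = X.act (σ a) (X.act (σ b) m) - X.act (σ b) (X.act (σ a) m) := by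
      rw [LieHom.map_lie, LieDerivation.lie_apply]
    have h2 : ⁅σ a, σ b⁆ = X.bd (F a b) + σ ⁅a, b⁆ := by rw [hF]; abel
    rw [h2, map_add, LieDerivation.add_apply, X.act_bd] at h1
    rw [add_assoc, h1]
    abel
  have der : ∀ (n : 𝔫) (a b : 𝔪), X.act n ⁅a, b⁆ = ⁅a, X.act n b⁆ - ⁅b, X.act n a⁆ :=
    fun n a b => LieDerivation.apply_lie_eq_sub _ _ _
  have J : β ⁅⁅x, y⁆, z⁆ = β ⁅x, ⁅y, z⁆⁆ - β ⁅y, ⁅x, z⁆⁆ := by rw [lie_lie, map_sub]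
  have J2 : β ⁅⁅x, z⁆, y⁆ = - β ⁅y, ⁅x, z⁆⁆ := by rw [← lie_skew, map_neg]
  have J3 : β ⁅⁅y, z⁆, x⁆ = - β ⁅x, ⁅y, z⁆⁆ := by rw [← lie_skew, map_neg]
  have J4 : ⁅β x, ⁅β y, β z⁆⁆ = ⁅β y, ⁅β x, β z⁆⁆ + ⁅β z, ⁅β y, β x⁆⁆ := by
    rw [leibniz_lie, ← lie_skew ⁅β x, β y⁆, ← lie_skew (β x) (β y), lie_neg, neg_neg, add_comm]
  simp only [formalAlong, hω, hβ, map_add, map_sub, LieDerivation.add_apply, X.act_bd, act, lie0,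
    der, J, J2, J3]
  rw [comm x y, comm x z, comm y z, J4, ← lie_skew (F x y) (β z), ← lie_skew (F x z) (β y),
    ← lie_skew (F y z) (β x), ← lie_skew (β x) (β y), ← lie_skew (β ⁅x, y⁆) (β z),
    ← lie_skew (β ⁅x, z⁆) (β y), ← lie_skew (β ⁅y, z⁆) (β x)]
  simp only [lie_neg]
  abel

/-- The pullback of the class of a crossed extension along `φ` can be computed from any linear
lift `τ` of `φ` and any lift `G` of its curvature. -/
lemma map_cls_eq_mk (X : CrossedExt k L M 𝔪 𝔫) (φ : L' →ₗ⁅k⁆ L) (ψ : M →ₗ[k] M')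
    (H : Compat φ ψ) (τ : L' →ₗ[k] 𝔫) (hτ : ∀ x, X.proj (τ x) = φ x) (G : twoCochain k L' 𝔪)
    (hG : ∀ x y, X.bd (G x y) = ⁅τ x, τ y⁆ - τ ⁅x, y⁆) (c : threeCocycle k L' M')
    (hc : ∀ x y z, c.1 x y z = ψ (X.toM (X.formalAlong τ G x y z))) :
    H3.map φ ψ H X.cls = H3.mk k L' M' c := by
  have hs := X.exists_section.choose_spec
  have hF := (X.exists_lift _ X.exists_section.choose_spec).choose_spec
  unfold cls
  set s := X.exists_section.choose
  set F := (X.exists_lift _ X.exists_section.choose_spec).choose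
  obtain ⟨ω, hω⟩ := X.exists_formalAlong_eq_add τ (s ∘ₗ (φ : L' →ₗ[k] L)) G
    (twoCochainMap φ LinearMap.id F) (fun x => (hs _).trans (hτ x).symm) hG (fun x y => by
      change X.bd (F (φ x) (φ y)) = ⁅s (φ x), s (φ y)⁆ - s (φ ⁅x, y⁆)
      rw [hF, LieHom.map_lie])
  refine (Submodule.Quotient.eq _).2 ⟨twoCochainMap LieHom.id ψ ω, ?_⟩
  ext x y z
  have h1 : X.formalAlong (s ∘ₗ (φ : L' →ₗ[k] L)) (twoCochainMap φ LinearMap.id F) x y z =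
      X.formal s F (φ x) (φ y) (φ z) := by
    unfold formalAlong formal
    simp only [← LieHom.map_lie]
    rfl
  have h2 := congrArg (fun e => ψ (X.toM e)) (hω x y z)
  simp only [h1, map_add, X.toM_incl, ← hc, map_sub, hτ, H _ _] at h2
  change _ = ψ (X.toM (X.formal s F (φ x) (φ y) (φ z))) - c.1 x y z
  rw [h2, add_sub_cancel_left]
  rfl

/-- The class of a crossed extension depends neither on the linear section nor on the lift of its
curvature. -/
lemma cls_eq_mk (X : CrossedExt k L M 𝔪 𝔫) (s : L →ₗ[k] 𝔫) (hs : ∀ x, X.proj (s x) = x)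
    (F : twoCochain k L 𝔪) (hF : ∀ x y, X.bd (F x y) = ⁅s x, s y⁆ - s ⁅x, y⁆) :
    X.cls = H3.mk k L M (X.cocycleOf s hs F hF) := by
  have H : Compat (LieHom.id : L →ₗ⁅k⁆ L) (LinearMap.id : M →ₗ[k] M) := fun _ _ => rfl
  rw [← X.map_cls_eq_mk LieHom.id LinearMap.id H s hs F hF (X.cocycleOf s hs F hF)
    (fun _ _ _ => rfl), H3.map_id]

end CrossedExt

section Naturality

variable {k g g' M : Type*} [Field k] [LieRing g] [LieAlgebra k g] [LieRing g'] [LieAlgebra k g']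
  [AddCommGroup M] [Module k M] [LieRingModule g M] [LieModule k g M]
  [LieRingModule g' M] [LieModule k g' M]
  {h : LieIdeal k g} {h' : LieIdeal k g'} (α : g' →ₗ⁅k⁆ g) (hα : ∀ z ∈ h', α z ∈ h)
  (hM : ∀ (x : g') (m : M), ⁅x, m⁆ = ⁅α x, m⁆)

/-! ### Pullback of derivations -/

/-- The restriction `d ↦ d ∘ α` of derivations, which induces `pullH1Ideal`. -/
def pullDer : LieDerivation k h M →ₗ[k] LieDerivation k h' M :=
  derMap (idealMap α hα) LinearMap.id (compat_idealMap α hα hM)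

lemma pullDer_apply (d : LieDerivation k h M) (z : h') :
    pullDer α hα hM d z = d (idealMap α hα z) := rfl

lemma pullH1Ideal_mk (d : LieDerivation k h M) :
    pullH1Ideal α hα hM (H1.mk k h M d) = H1.mk k h' M (pullDer α hα hM d) := rfl

lemma idealMap_lie (x : g') (z : h') : idealMap α hα ⁅x, z⁆ = ⁅α x, idealMap α hα z⁆ :=
  Subtype.ext (LieHom.map_lie α x z)

lemma pullDer_lie (x : g') (d : LieDerivation k h M) :
    pullDer α hα hM ⁅α x, d⁆ = ⁅x, pullDer α hα hM d⁆ := by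
  ext z
  rw [lie_der_apply, pullDer_apply, pullDer_apply, pullDer_apply, lie_der_apply, idealMap_lie, hM]

lemma pullDer_inner (m : M) :
    pullDer α hα hM (LieDerivation.inner k h M m) = LieDerivation.inner k h' M m := by
  ext z
  exact (hM z m).symm

/-! ### Naturality of `tr` -/

/-- The homomorphism `M ⋊ g' → M ⋊ g` over `α` given by `(x, m) ↦ (α x, m - x · n)`. The twist by
`n` matches the change of a derivation `h' → M` by the inner derivation of `n`. -/
def semiMap (n : M) : SemiProd g' M →ₗ⁅k⁆ SemiProd g M where
  toFun p := ⟨α p.fst, p.snd - ⁅p.fst, n⁆⟩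
  map_add' := by
    rintro ⟨x, m⟩ ⟨y, l⟩
    simp only [SemiProd.add_mk, map_add, add_lie, add_sub_add_comm]
  map_smul' := by
    rintro t ⟨x, m⟩
    simp only [SemiProd.smul_mk, map_smul, smul_lie, smul_sub, RingHom.id_apply]
  map_lie' := by
    rintro ⟨x, m⟩ ⟨y, l⟩
    simp only [SemiProd.lie_mk, LieHom.map_lie, SemiProd.mk.injEq, true_and, ← hM, lie_sub,
      lie_lie]
    abel

lemma semiMap_apply (n : M) (x : g') (m : M) :
    semiMap α hM n ⟨x, m⟩ = ⟨α x, m - ⁅x, n⁆⟩ := rfl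

lemma eq_of_semiMap_eq (n : M) {p q : SemiProd g' M} (h1 : p.fst = q.fst)
    (h2 : semiMap α hM n p = semiMap α hM n q) : p = q := by
  obtain ⟨x, m⟩ := p
  obtain ⟨y, l⟩ := q
  obtain rfl : x = y := h1
  have h3 : m - ⁅x, n⁆ = l - ⁅x, n⁆ := congrArg SemiProd.snd h2
  rw [sub_left_inj.1 h3]

lemma semiMap_splitOf (n : M) (d : LieDerivation k h M) (d' : LieDerivation k h' M)
    (hd : d' = pullDer α hα hM d + LieDerivation.inner k h' M n) (z : h') :
    semiMap α hM n (splitOf h' d' z) = splitOf h d (idealMap α hα z) := by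
  change (⟨α z, d' z - ⁅(z : g'), n⁆⟩ : SemiProd g M) = ⟨α z, d (idealMap α hα z)⟩
  have h1 : d' z = d (idealMap α hα z) + ⁅(z : g'), n⁆ := by rw [hd]; rfl
  rw [h1, add_sub_cancel_right]

/-- An element of `M ⋊ g'` idealizes the graph of `d'` if its image in `M ⋊ g` idealizes the graph
of `d`. -/
lemma mem_idealizer_of_semiMap (n : M) (d : LieDerivation k h M) (d' : LieDerivation k h' M)
    (hd : d' = pullDer α hα hM d + LieDerivation.inner k h' M n) {p : SemiProd g' M}
    (hp : semiMap α hM n p ∈ idealizer (splitOf h d)) : p ∈ idealizer (splitOf h' d') := by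
  rw [LieSubalgebra.mem_normalizer_iff] at hp ⊢
  rintro _ ⟨z, rfl⟩
  refine ⟨⁅p.fst, z⁆, ?_⟩
  obtain ⟨w, hw⟩ := hp _ ⟨idealMap α hα z, rfl⟩
  replace hw : splitOf h d w = ⁅semiMap α hM n p, splitOf h d (idealMap α hα z)⁆ := hw
  have h1 : w = idealMap α hα ⁅p.fst, z⁆ :=
    Subtype.ext ((congrArg SemiProd.fst hw).trans (LieHom.map_lie α p.fst z).symm)
  refine eq_of_semiMap_eq α hM n rfl ?_
  change semiMap α hM n (splitOf h' d' ⁅p.fst, z⁆) = semiMap α hM n ⁅p, splitOf h' d' z⁆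
  rw [LieHom.map_lie, semiMap_splitOf α hα hM n d d' hd, semiMap_splitOf α hα hM n d d' hd, ← hw,
    h1]

/-- Allowing `d'` to differ from `d ∘ α` by an inner derivation makes this both the naturality of
`trHat` and, for `α` the identity, its independence of the representative of the class. -/
lemma map_trHat (n : M) (d : LieDerivation k h M) (d' : LieDerivation k h' M)
    (hd : d' = pullDer α hα hM d + LieDerivation.inner k h' M n)
    (hi : H1.mk k h M d ∈ InvH1 M h) (hi' : H1.mk k h' M d' ∈ InvH1 M h') :
    pullH2Quot α hα hM (trHat h d hi) = trHat h' d' hi' := by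
  -- the span consists of the elements of `M ⋊ g'` whose image idealizes the graph of `d`
  let P : LieSubalgebra k (SemiProd g' M) := (idealizer (splitOf h d)).comap (semiMap α hM n)
  let a₀ : P →ₗ⁅k⁆ idealizer (splitOf h d) :=
    { toFun := fun p => ⟨semiMap α hM n p, p.2⟩
      map_add' := fun p q => Subtype.ext (map_add (semiMap α hM n) (p : SemiProd g' M) q)
      map_smul' := fun t p => Subtype.ext (map_smul (semiMap α hM n) t (p : SemiProd g' M))
      map_lie' := fun {p q} =>
        Subtype.ext (LieHom.map_lie (semiMap α hM n) (p : SemiProd g' M) q) }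
  let b₀ : P →ₗ⁅k⁆ idealizer (splitOf h' d') :=
    { toFun := fun p => ⟨p, mem_idealizer_of_semiMap α hα hM n d d' hd p.2⟩
      map_add' := fun _ _ => rfl
      map_smul' := fun _ _ => rfl
      map_lie' := rfl }
  refine ModExt.map_cls_of_span _ _ (quotMap α hα) (invIncl α hα hM) (compat_invIncl α hα hM)
    ((quotMk (rangeIdeal (splitOf h d))).comp a₀) ((quotMk (rangeIdeal (splitOf h' d'))).comp b₀)
    (fun p => rfl) (fun x => ?_) (fun p m hp hp' => ?_)
  · obtain ⟨x, rfl⟩ := Submodule.Quotient.mk_surjective _ x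
    obtain ⟨e, he⟩ := ((splitExt k g M).omega (splitOf h d) (proj_splitOf h d)
      (defect_splitOf_inner h d hi)).proj_surjective (quotMk h (α x))
    obtain ⟨e, rfl⟩ := Submodule.Quotient.mk_surjective _ e
    have hz : (e : SemiProd g M).fst - α x ∈ h := (Submodule.Quotient.eq _).1 he
    set z : h := ⟨_, hz⟩
    refine ⟨⟨⟨x, ((e : SemiProd g M) - splitOf h d z).snd + ⁅x, n⁆⟩, ?_⟩, rfl⟩
    have h1 : semiMap α hM n ⟨x, ((e : SemiProd g M) - splitOf h d z).snd + ⁅x, n⁆⟩ =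
        (e : SemiProd g M) - splitOf h d z := by
      rw [semiMap_apply, add_sub_cancel_right]
      refine SemiProd.ext ?_ rfl
      change α x = (e : SemiProd g M).fst - ((e : SemiProd g M).fst - α x)
      rw [sub_sub_cancel]
    change semiMap α hM n _ ∈ idealizer (splitOf h d)
    rw [h1]
    exact sub_mem e.2 (LieSubalgebra.le_normalizer _ ⟨z, rfl⟩)
  · obtain ⟨p, hpP⟩ := p
    have hz : p.fst ∈ h' := (Submodule.Quotient.mk_eq_zero _).1 hp'
    obtain ⟨w, hw⟩ := (Submodule.Quotient.eq (rangeIdeal (splitOf h d)).toSubmodule).1 hp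
    replace hw : splitOf h d w = semiMap α hM n p - (⟨0, m⟩ : SemiProd g M) := hw
    have h1 : w = idealMap α hα ⟨p.fst, hz⟩ :=
      Subtype.ext ((congrArg SemiProd.fst hw).trans (sub_zero _))
    refine (Submodule.Quotient.eq (rangeIdeal (splitOf h' d')).toSubmodule).2 ⟨⟨p.fst, hz⟩, ?_⟩
    change splitOf h' d' ⟨p.fst, hz⟩ = p - (⟨0, m⟩ : SemiProd g' M)
    refine eq_of_semiMap_eq α hM n (sub_zero _).symm ?_
    rw [semiMap_splitOf α hα hM n d d' hd, ← h1, hw, map_sub, semiMap_apply α hM n 0, map_zero,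
      zero_lie, sub_zero]

lemma tr_natural (c : InvH1 M h) :
    tr h' (pullInvH1 α hα hM c) = pullH2Quot α hα hM (tr h c) := by
  have h1 := (InvH1.exists_rep c).choose_spec
  have h2 := (InvH1.exists_rep (pullInvH1 α hα hM c)).choose_spec
  have h3 : H1.mk k h' M ((InvH1.exists_rep (pullInvH1 α hα hM c)).choose -
      pullDer α hα hM (InvH1.exists_rep c).choose) = 0 := by
    rw [map_sub, h2, ← pullH1Ideal_mk, h1]
    exact sub_self _
  obtain ⟨n, hn⟩ := H1.mk_eq_zero.1 h3
  exact (map_trHat α hα hM n _ _ (by rw [hn, add_sub_cancel]) _ _).symm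

/-! ### Naturality of `ρ` -/

section Rho

variable {E E' : Type*} [LieRing E] [LieAlgebra k E] [LieRing E'] [LieAlgebra k E']

/-- A morphism of extensions over `α` which is the identity on `M` need not respect the partial
splittings. They differ by a derivation `e : h' → M`, and the two derivations with values in
`H¹(h', M)` differ by the inner derivation of `[e]`. -/
lemma map_mk_rhoBar (X : ModExt k g M E) (s : h →ₗ⁅k⁆ E) (hs : ∀ z : h, X.proj (s z) = z)
    (X' : ModExt k g' M E') (s' : h' →ₗ⁅k⁆ E') (hs' : ∀ z : h', X'.proj (s' z) = z)
    (Θ : E' →ₗ⁅k⁆ E) (hi : ∀ m, Θ (X'.incl m) = X.incl m)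
    (hp : ∀ y, X.proj (Θ y) = α (X'.proj y)) :
    pullH1H1 α hα hM (H1.mk k (g ⧸ h) (H1 k h M) (rhoBar X s hs)) =
      H1.mk k (g' ⧸ h') (H1 k h' M) (rhoBar X' s' hs') := by
  have hdiff : ∀ z : h', X.incl (X.toM (Θ (s' z) - s (idealMap α hα z))) =
      Θ (s' z) - s (idealMap α hα z) := fun z => X.incl_toM (by
    rw [map_sub, hp, hs, hs']
    exact sub_self _)
  let e : LieDerivation k h' M :=
    { toLinearMap := X.toM ∘ₗ ((Θ : E' →ₗ[k] E) ∘ₗ (s' : h' →ₗ[k] E') -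
        (s : h →ₗ[k] E) ∘ₗ (idealMap α hα : h' →ₗ[k] h))
      leibniz' := fun z w => by
        apply X.incl_injective
        change X.incl (X.toM (Θ (s' ⁅z, w⁆) - s (idealMap α hα ⁅z, w⁆))) =
          X.incl (⁅(z : g'), X.toM (Θ (s' w) - s (idealMap α hα w))⁆ -
            ⁅(w : g'), X.toM (Θ (s' z) - s (idealMap α hα z))⁆)
        have h1 : ∀ (z : h') (m : M), X.incl ⁅(z : g'), m⁆ = ⁅Θ (s' z), X.incl m⁆ := fun z m => by
          rw [X.lie_incl, hp, hs', hM]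
        have h2 : ∀ (z : h') (m : M), X.incl ⁅(z : g'), m⁆ = ⁅s (idealMap α hα z), X.incl m⁆ :=
          fun z m => by
            rw [X.lie_incl, hs, hM]
            rfl
        rw [hdiff, map_sub, h1, h2, hdiff, hdiff, LieHom.map_lie, LieHom.map_lie, LieHom.map_lie,
          LieHom.map_lie, lie_sub, lie_sub, ← lie_skew (s (idealMap α hα w)) (Θ (s' z)),
          ← lie_skew (s (idealMap α hα w)) (s (idealMap α hα z))]
        abel }
  have he : ∀ z : h', X.incl (e z) = Θ (s' z) - s (idealMap α hα z) := hdiff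
  refine (Submodule.Quotient.eq _).2 ⟨- H1.mk k h' M e, ?_⟩
  ext x
  obtain ⟨x, rfl⟩ := Submodule.Quotient.mk_surjective _ x
  obtain ⟨y, rfl⟩ := X'.proj_surjective x
  change ⁅quotMk h' (X'.proj y), - H1.mk k h' M e⁆ =
    pullH1Ideal α hα hM (rhoBar X s hs (quotMk h (α (X'.proj y)))) -
      rhoBar X' s' hs' (quotMk h' (X'.proj y))
  rw [← hp, rhoBar_apply, rhoBar_apply, pullH1Ideal_mk, ← map_sub, lie_neg, quotMk_apply,
    mk_lie_h1, ← map_neg]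
  congr 1
  ext z
  apply X.incl_injective
  rw [LieDerivation.neg_apply, LieDerivation.sub_apply, lie_der_apply, pullDer_apply, map_neg,
    map_sub, map_sub, X.incl_defect, he, idealMap_lie, ← hi (X'.defect s' hs' y z),
    X'.incl_defect, hM, ← hp, ← X.lie_incl, he, map_sub, LieHom.map_lie, lie_sub, hp]
  abel

end Rho

/-- The morphism of extensions given by a 1-cochain `γ` whose coboundary is the difference of a
2-cocycle and the pullback of another. -/
def cocycleExtMap (f : twoCocycle k g M) (f' : twoCocycle k g' M) (γ : g' →ₗ[k] M)
    (hγ : ∀ x y, f'.1 x y = f.1 (α x) (α y) + (⁅x, γ y⁆ - ⁅y, γ x⁆ - γ ⁅x, y⁆)) :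
    LieAlgebra.ofTwoCocycle f' →ₗ⁅k⁆ LieAlgebra.ofTwoCocycle f where
  toFun p := ⟨(α p.carrier.1, p.carrier.2 + γ p.carrier.1)⟩
  map_add' := by
    rintro ⟨x, m⟩ ⟨y, n⟩
    change (⟨(α (x + y), m + n + γ (x + y))⟩ : LieAlgebra.ofTwoCocycle f) =
      ⟨(α x + α y, (m + γ x) + (n + γ y))⟩
    rw [map_add, map_add, add_add_add_comm]
  map_smul' := by
    rintro t ⟨x, m⟩
    change (⟨(α (t • x), t • m + γ (t • x))⟩ : LieAlgebra.ofTwoCocycle f) =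
      ⟨(t • α x, t • (m + γ x))⟩
    rw [map_smul, map_smul, smul_add]
  map_lie' := by
    rintro ⟨x, m⟩ ⟨y, n⟩
    change (⟨(α ⁅x, y⁆, f'.1 x y + ⁅x, n⁆ - ⁅y, m⁆ + γ ⁅x, y⁆)⟩ : LieAlgebra.ofTwoCocycle f) =
      ⟨(⁅α x, α y⁆, f.1 (α x) (α y) + ⁅α x, n + γ y⁆ - ⁅α y, m + γ x⁆)⟩
    have h1 : f'.1 x y + ⁅x, n⁆ - ⁅y, m⁆ + γ ⁅x, y⁆ =
        f.1 (α x) (α y) + ⁅α x, n + γ y⁆ - ⁅α y, m + γ x⁆ := by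
      rw [hγ, ← hM, ← hM, lie_add, lie_add]
      abel
    rw [h1, LieHom.map_lie]

lemma rho_natural (c : H2one M h) :
    rho (pullH2one α hα hM c) = pullH1H1 α hα hM (rho c) := by
  have h1 := (H2one.exists_split c).choose_spec.1
  have h2 := (H2one.exists_split (pullH2one α hα hM c)).choose_spec.1
  have h3 : H2.mk k g' M (H2one.exists_split (pullH2one α hα hM c)).choose =
      H2.mk k g' M (twoCocycleMap α LinearMap.id (compat_id α hM)
        (H2one.exists_split c).choose) := by
    rw [h2]
    exact congrArg (H2.map α LinearMap.id (compat_id α hM)) h1.symm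
  obtain ⟨γ, hγ⟩ := (Submodule.Quotient.eq _).1 h3
  refine (map_mk_rhoBar α hα hM _ _ _ _ _ _
    (cocycleExtMap α hM (H2one.exists_split c).choose
      (H2one.exists_split (pullH2one α hα hM c)).choose γ fun x y => ?_)
    (fun m => ?_) (fun y => rfl)).symm
  · exact sub_eq_iff_eq_add'.1
      (congrArg (fun t : twoCochain k g' M => t x y) hγ).symm
  · change (⟨(α 0, m + γ 0)⟩ : LieAlgebra.ofTwoCocycle _) = ⟨(0, m)⟩
    rw [map_zero, map_zero, add_zero]

/-! ### Naturality of `λ` -/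

variable (h) in
/-- The map `m ↦ (z ↦ z · m)` has a linear partial inverse, defined on all derivations. -/
lemma exists_inner_section : ∃ r : LieDerivation k h M →ₗ[k] M, ∀ d, H1.mk k h M d = 0 →
    LieDerivation.inner k h M (r d) = d := by
  obtain ⟨t, ht⟩ := LinearMap.exists_rightInverse_of_surjective
    (LieDerivation.inner k h M).rangeRestrict (LinearMap.range_rangeRestrict _)
  obtain ⟨r, hr⟩ := LinearMap.exists_extend t
  refine ⟨r, fun d hd => ?_⟩
  obtain ⟨m, rfl⟩ := H1.mk_eq_zero.1 hd
  have h1 : r (LieDerivation.inner k h M m) = t ⟨LieDerivation.inner k h M m, ⟨m, rfl⟩⟩ :=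
    LinearMap.congr_fun hr (⟨LieDerivation.inner k h M m, ⟨m, rfl⟩⟩ :
      LinearMap.range (LieDerivation.inner k h M))
  rw [h1]
  exact congrArg Subtype.val (LinearMap.congr_fun ht ⟨LieDerivation.inner k h M m, ⟨m, rfl⟩⟩)

/-- The linear map `M ⋊ h' → M ⋊ h` induced by `α`. -/
def semiPush : SemiProd h' M →ₗ[k] SemiProd h M where
  toFun v := ⟨idealMap α hα v.fst, v.snd⟩
  map_add' v w := SemiProd.ext (map_add (idealMap α hα) v.fst w.fst) rfl
  map_smul' t v := SemiProd.ext (map_smul (idealMap α hα) t v.fst) rfl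

/-- The linear automorphism `(z, m) ↦ (z, m - e z)` of `M ⋊ h'`. It carries the action of `(x, d)`
to that of `(x, d + x · e)`. -/
def semiShear (e : LieDerivation k h' M) : SemiProd h' M →ₗ[k] SemiProd h' M where
  toFun v := ⟨v.fst, v.snd - e v.fst⟩
  map_add' := by
    rintro ⟨z, m⟩ ⟨w, n⟩
    simp only [SemiProd.add_mk, map_add, add_sub_add_comm]
  map_smul' := by
    rintro t ⟨z, m⟩
    simp only [SemiProd.smul_mk, map_smul, smul_sub, RingHom.id_apply]

lemma semiPush_act (x : g') (d : LieDerivation k h M)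
    (v : SemiProd h' M) :
    semiPush α hα (semiActDer x (pullDer α hα hM d) v) =
      semiActDer (α x) d (semiPush (M := M) α hα v) := by
  obtain ⟨z, m⟩ := v
  change (⟨idealMap α hα ⁅x, z⁆, ⁅x, m⁆ + d (idealMap α hα z)⟩ : SemiProd h M) =
    ⟨⁅α x, idealMap α hα z⁆, ⁅α x, m⁆ + d (idealMap α hα z)⟩
  rw [idealMap_lie, hM]

lemma semiShear_act (x : g') (d e : LieDerivation k h' M) (v : SemiProd h' M) :
    semiShear e (semiActDer x d v) = semiActDer x (d + ⁅x, e⁆) (semiShear e v) := by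
  obtain ⟨z, m⟩ := v
  change (⟨⁅x, z⁆, ⁅x, m⁆ + d z - e ⁅x, z⁆⟩ : SemiProd h' M) =
    ⟨⁅x, z⁆, ⁅x, m - e z⁆ + (d z + (⁅x, e z⁆ - e ⁅x, z⁆))⟩
  rw [lie_sub]
  congr 1
  abel

/-- Derivations `D` and `D'` which correspond up to the inner derivation of `[e]` have corresponding
crossed extensions: a linear section for `D'` and a linear lift of `g' ⧸ h' → g ⧸ h` for `D` can be
built from the same data, and the lifts of their curvatures are images of one cochain `B` with
values in `M ⋊ h'`. -/
lemma map_lamHat (D : LieDerivation k (g ⧸ h) (H1 k h M))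
    (D' : LieDerivation k (g' ⧸ h') (H1 k h' M)) (e : LieDerivation k h' M)
    (hD : ∀ x : g', D' (quotMk h' x) =
      pullH1Ideal α hα hM (D (quotMk h (α x))) + H1.mk k h' M ⁅x, e⁆) :
    pullH3Quot α hα hM (lamHat D) = lamHat D' := by
  -- linear sections of the projections `g' → g' ⧸ h'` and `Der(h, M) → H¹(h, M)`
  obtain ⟨σ, hσ⟩ := LinearMap.exists_rightInverse_of_surjective
    (quotMk h' : g' →ₗ[k] g' ⧸ h')
    (LinearMap.range_eq_top.2 (Submodule.Quotient.mk_surjective _))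
  replace hσ : ∀ x, quotMk h' (σ x) = x := fun x => LinearMap.congr_fun hσ x
  obtain ⟨ν, hν⟩ := LinearMap.exists_rightInverse_of_surjective (H1.mk k h M)
    (LinearMap.range_eq_top.2 H1.exists_rep)
  replace hν : ∀ c, H1.mk k h M (ν c) = c := fun c => LinearMap.congr_fun hν c
  let δ : (g' ⧸ h') →ₗ[k] LieDerivation k h M :=
    ν ∘ₗ (D : (g ⧸ h) →ₗ[k] H1 k h M) ∘ₗ (quotMap α hα : (g' ⧸ h') →ₗ[k] g ⧸ h)
  have hασ : ∀ x, quotMk h (α (σ x)) = quotMap α hα x := fun x =>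
    (congrArg (quotMap α hα) (hσ x) : quotMap α hα (quotMk h' (σ x)) = _)
  have hδ : ∀ x, D (quotMk h (α (σ x))) = H1.mk k h M (δ x) := fun x => by
    rw [hασ]
    exact (hν _).symm
  -- linear lifts on `h'` and on the inner derivations
  obtain ⟨π, hπ⟩ := LinearMap.exists_leftInverse_of_injective h'.toSubmodule.subtype
    (Submodule.ker_subtype _)
  obtain ⟨r, hr⟩ := exists_inner_section (M := M) h
  let B : twoCochain k (g' ⧸ h') (SemiProd h' M) :=
    ⟨LinearMap.mk₂ k (fun x y => ⟨π (⁅σ x, σ y⁆ - σ ⁅x, y⁆),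
        - r (⁅α (σ x), δ y⁆ - ⁅α (σ y), δ x⁆ - δ ⁅x, y⁆)⟩)
      (fun _ _ _ => by
        simp only [SemiProd.add_mk, map_add, map_sub, add_lie, lie_add, SemiProd.mk.injEq]
        constructor <;> abel)
      (fun _ _ _ => by
        rw [SemiProd.smul_mk, smul_neg, ← map_smul, ← map_smul]
        simp only [map_smul, smul_lie, lie_smul, smul_sub])
      (fun _ _ _ => by
        simp only [SemiProd.add_mk, map_add, map_sub, add_lie, lie_add, SemiProd.mk.injEq]
        constructor <;> abel)
      (fun _ _ _ => by
        rw [SemiProd.smul_mk, smul_neg, ← map_smul, ← map_smul]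
        simp only [map_smul, smul_lie, lie_smul, smul_sub]),
    fun x => by
      simp only [LinearMap.mk₂_apply, lie_self, map_zero, sub_self, neg_zero]
      rfl⟩
  have hB₁ : ∀ x y, ((B x y).fst : g') = ⁅σ x, σ y⁆ - σ ⁅x, y⁆ := fun x y => by
    have h1 : ⁅σ x, σ y⁆ - σ ⁅x, y⁆ ∈ h' := quotMk_eq_zero.1 (by
      rw [map_sub, LieHom.map_lie, hσ, hσ, hσ, sub_self])
    exact congrArg Subtype.val (LinearMap.congr_fun hπ ⟨_, h1⟩)
  have hB₂ : ∀ x y, - LieDerivation.inner k h M (B x y).snd =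
      ⁅α (σ x), δ y⁆ - ⁅α (σ y), δ x⁆ - δ ⁅x, y⁆ := fun x y => by
    have h1 : H1.mk k h M (⁅α (σ x), δ y⁆ - ⁅α (σ y), δ x⁆ - δ ⁅x, y⁆) = 0 := by
      rw [map_sub, map_sub, ← mk_lie_h1, ← mk_lie_h1, ← hδ, ← hδ, ← hδ, hασ, hασ, hασ,
        LieHom.map_lie, LieDerivation.apply_lie_eq_sub, ← hασ, ← hασ]
      exact sub_self _
    change - LieDerivation.inner k h M (- r _) = _
    rw [map_neg, neg_neg, hr _ h1]
  let τ : (g' ⧸ h') →ₗ[k] pAlg D :=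
    { toFun := fun x => ⟨⟨α (σ x), δ x⟩, hδ x⟩
      map_add' := fun x y => Subtype.ext (by
        change (⟨α (σ (x + y)), δ (x + y)⟩ : SemiProd g (LieDerivation k h M)) =
          ⟨α (σ x) + α (σ y), δ x + δ y⟩
        simp only [map_add])
      map_smul' := fun t x => Subtype.ext (by
        change (⟨α (σ (t • x)), δ (t • x)⟩ : SemiProd g (LieDerivation k h M)) =
          ⟨t • α (σ x), t • δ x⟩
        simp only [map_smul]) }
  let s : (g' ⧸ h') →ₗ[k] pAlg D' :=
    { toFun := fun x => ⟨⟨σ x, pullDer α hα hM (δ x) + ⁅σ x, e⁆⟩, by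
        change D' (quotMk h' (σ x)) = H1.mk k h' M (pullDer α hα hM (δ x) + ⁅σ x, e⁆)
        rw [hD, hδ, map_add, pullH1Ideal_mk]⟩
      map_add' := fun x y => Subtype.ext (by
        change (⟨σ (x + y), pullDer α hα hM (δ (x + y)) + ⁅σ (x + y), e⁆⟩ :
            SemiProd g' (LieDerivation k h' M)) =
          ⟨σ x + σ y, (pullDer α hα hM (δ x) + ⁅σ x, e⁆) + (pullDer α hα hM (δ y) + ⁅σ y, e⁆)⟩
        simp only [map_add, add_lie, add_add_add_comm])
      map_smul' := fun t x => Subtype.ext (by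
        change (⟨σ (t • x), pullDer α hα hM (δ (t • x)) + ⁅σ (t • x), e⁆⟩ :
            SemiProd g' (LieDerivation k h' M)) =
          ⟨t • σ x, t • (pullDer α hα hM (δ x) + ⁅σ x, e⁆)⟩
        simp only [map_smul, smul_lie, smul_add]) }
  let G := twoCochainMap (LieHom.id : (g' ⧸ h') →ₗ⁅k⁆ g' ⧸ h') (semiPush (M := M) α hα) B
  let F := twoCochainMap (LieHom.id : (g' ⧸ h') →ₗ⁅k⁆ g' ⧸ h') (semiShear e) B
  have hG : ∀ x y, (crossedOf D).bd (G x y) = ⁅τ x, τ y⁆ - τ ⁅x, y⁆ := fun x y => by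
    refine Subtype.ext (SemiProd.ext ?_ (hB₂ x y))
    change α (B x y).fst = ⁅α (σ x), α (σ y)⁆ - α (σ ⁅x, y⁆)
    rw [hB₁, map_sub, LieHom.map_lie]
  have hF : ∀ x y, (crossedOf D').bd (F x y) = ⁅s x, s y⁆ - s ⁅x, y⁆ := fun x y => by
    refine Subtype.ext (SemiProd.ext (hB₁ x y) ?_)
    change - LieDerivation.inner k h' M ((B x y).snd - e (B x y).fst) =
      ⁅σ x, pullDer α hα hM (δ y) + ⁅σ y, e⁆⁆ - ⁅σ y, pullDer α hα hM (δ x) + ⁅σ x, e⁆⁆ -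
        (pullDer α hα hM (δ ⁅x, y⁆) + ⁅σ ⁅x, y⁆, e⁆)
    have h1 : LieDerivation.inner k h' M (e (B x y).fst) = ⁅⁅σ x, σ y⁆ - σ ⁅x, y⁆, e⁆ := by
      rw [← hB₁, mem_lie_der h' _ (B x y).fst.2]
    rw [map_sub, h1, ← pullDer_inner α hα hM, neg_sub, sub_eq_add_neg, ← map_neg, hB₂, map_sub,
      map_sub, pullDer_lie, pullDer_lie, sub_lie, lie_lie, lie_add, lie_add]
    abel
  have hs : ∀ x, (crossedOf D').proj (s x) = x := hσ
  unfold lamHat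
  rw [(crossedOf D').cls_eq_mk s hs F hF]
  refine (crossedOf D).map_cls_eq_mk _ _ (compat_invIncl α hα hM) τ hασ G hG _ fun x y z => ?_
  apply (crossedOf D').incl_injective
  -- the common preimage in `M ⋊ h'` of the two formal coboundaries
  let A : (g' ⧸ h') → SemiProd h' M → SemiProd h' M :=
    fun x => semiActDer (σ x) (pullDer α hα hM (δ x))
  let C : SemiProd h' M := A x (B y z) - A y (B x z) + A z (B x y) - B ⁅x, y⁆ z + B ⁅x, z⁆ y -
    B ⁅y, z⁆ x
  have hCG : (crossedOf D).formalAlong τ G x y z = semiPush (M := M) α hα C := by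
    simp only [C, A, map_sub, map_add, semiPush_act]
    rfl
  have hCF : (crossedOf D').formal s F x y z = semiShear e C := by
    simp only [C, A, map_sub, map_add, semiShear_act]
    rfl
  have h1 := (crossedOf D').bd_formal s F hF x y z
  rw [hCF] at h1
  have h2 : C.fst = 0 := Subtype.ext (congrArg (fun v => v.1.fst) h1)
  obtain ⟨m, hm⟩ := ((crossedOf D).exact_left _).1 ((crossedOf D).bd_formalAlong τ G hG x y z)
  rw [← hm, (crossedOf D).toM_incl]
  refine ((crossedOf D').incl_cochainOf s F hF x y z).trans (hCF.trans ?_)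
  refine SemiProd.ext h2 ?_
  have h3 : (m : M) = C.snd := congrArg SemiProd.snd (hm.trans hCG)
  change C.snd - e C.fst = m
  rw [h2, map_zero, sub_zero, h3]

lemma lam_natural (c : H1 k (g ⧸ h) (H1 k h M)) :
    lam (pullH1H1 α hα hM c) = pullH3Quot α hα hM (lam c) := by
  have h1 := (H1.exists_rep c).choose_spec
  have h2 := (H1.exists_rep (pullH1H1 α hα hM c)).choose_spec
  unfold lam
  set D := (H1.exists_rep c).choose
  set D' := (H1.exists_rep (pullH1H1 α hα hM c)).choose
  have h3 : H1.mk k (g' ⧸ h') (H1 k h' M) D' = H1.mk k (g' ⧸ h') (H1 k h' M)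
      (derMap _ _ (compat_pullH1Ideal α hα hM) D) :=
    h2.trans (congrArg (pullH1H1 α hα hM) h1.symm)
  obtain ⟨b, hb⟩ := (Submodule.Quotient.eq _).1 h3
  obtain ⟨e, rfl⟩ := H1.exists_rep b
  refine (map_lamHat α hα hM D D' e fun x => ?_).symm
  exact sub_eq_iff_eq_add'.1 (LieDerivation.congr_fun hb (quotMk h' x)).symm

/-! ### Naturality of inflation and restriction -/

lemma infl₁_natural (c : H1 k (g ⧸ h) (Inv M h)) :
    infl₁ M h' (pullH1Quot α hα hM c) = pullH1 α hM (infl₁ M h c) := by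
  obtain ⟨d, rfl⟩ := H1.exists_rep c
  rfl

lemma res₁_natural (c : H1 k g M) :
    res₁ M h' (pullH1 α hM c) = pullInvH1 α hα hM (res₁ M h c) := by
  obtain ⟨d, rfl⟩ := H1.exists_rep c
  rfl

lemma infl₂_natural (c : H2 k (g ⧸ h) (Inv M h)) :
    infl₂ M h' (pullH2Quot α hα hM c) = pullH2one α hα hM (infl₂ M h c) := by
  obtain ⟨f, rfl⟩ := Submodule.Quotient.mk_surjective _ c
  rfl

end Naturality

end LieExt

open LieExt in
theorem mainTheorem9 {k g g' M : Type*} [Field k]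
    [LieRing g] [LieAlgebra k g] [LieRing g'] [LieAlgebra k g']
    [AddCommGroup M] [Module k M]
    [LieRingModule g M] [LieModule k g M] [LieRingModule g' M] [LieModule k g' M]
    (h : LieIdeal k g) (h' : LieIdeal k g')
    (α : g' →ₗ⁅k⁆ g) (hα : ∀ z ∈ h', α z ∈ h)
    (hM : ∀ (x : g') (m : M), ⁅x, m⁆ = ⁅α x, m⁆) :
    (∀ c : H1 k (g ⧸ h) (Inv M h),
      infl₁ M h' (pullH1Quot α hα hM c) = pullH1 α hM (infl₁ M h c)) ∧
    (∀ c : H1 k g M,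
      res₁ M h' (pullH1 α hM c) = pullInvH1 α hα hM (res₁ M h c)) ∧
    (∀ c : InvH1 M h,
      tr h' (pullInvH1 α hα hM c) = pullH2Quot α hα hM (tr h c)) ∧
    (∀ c : H2 k (g ⧸ h) (Inv M h),
      infl₂ M h' (pullH2Quot α hα hM c) = pullH2one α hα hM (infl₂ M h c)) ∧
    (∀ c : H2one M h,
      rho (pullH2one α hα hM c) = pullH1H1 α hα hM (rho c)) ∧
    (∀ c : H1 k (g ⧸ h) (H1 k h M),
      lam (pullH1H1 α hα hM c) = pullH3Quot α hα hM (lam c)) :=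
  ⟨infl₁_natural α hα hM, res₁_natural α hα hM, tr_natural α hα hM, infl₂_natural α hα hM,
    rho_natural α hα hM, lam_natural α hα hM⟩
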